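/- **Splitting formula.** Let $V:\mathbb{R}^2\to\mathbb{R}$ be of class $C^3$ with $\frac{V(x)}{2}-\log|x|\to+\infty$ as $|x|\to\infty$, and suppose that $\underline m\le\frac{\Delta V}{4\pi}\le\overline m$ on $\mathbb{R}^2$ for some constants $\underline m,\overline m>0$. Put $$I(\mu)=\iint_{\mathbb{R}^2\times\mathbb{R}^2}-\log|x-y|\,d\mu(x)\,d\mu(y)+\int_{\mathbb{R}^2}V\,d\mu$$ for probability measures $\mu$ on $\mathbb{R}^2$ (with $I(\mu)=+\infty$ if $V$ is not $\mu$-integrable), and let $\mu_0$ be the equilibrium measure, that is, the minimizer of $I$ among probability measures. Let $m_0$ be the Lebesgue density of $\mu_0$, and for a measure $\mu$ let $U^{\mu}(x)=-\int\log|x-y|\,d\mu(y)$. There is a constant $c\in\mathbb{R}$ such that, quasi-everywhere (i.e. outside a set of zero logarithmic capacity), $U^{\mu_0}+\frac V2\ge c$ on $\mathbb{R}^2$ and $U^{\mu_0}+\frac V2=c$ on the support of $\mu_0$. For any such $c$, put $\zeta=U^{\mu_0}+\frac V2-c$. Let $n\ge1$ and $x_1,\dots,x_n\in\mathbb{R}^2$,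 and put $$w_n(x_1,\dots,x_n)=-\sum_{i\ne j}\log|x_i-x_j|+n\sum_{i=1}^nV(x_i)$$ (equal to $+\infty$ if two of the points coincide). Let $x_i'=\sqrt n\,x_i$, $d\mu_0'(x')=m_0(x'/\sqrt n)\,dx'$, and $$H_n'(x)=-\sum_{i=1}^n\log|x-x_i'|+\int\log|x-y|\,d\mu_0'(y).$$ Then the limit $$W(\nabla H_n',\mathbf 1_{\mathbb{R}^2})=\lim_{\eta\to0^+}\Big(\frac12\int_{\mathbb{R}^2\setminus\bigcup_iB(x_i',\eta)}|\nabla H_n'|^2+\pi n\log\eta\Big)$$ exists in $(-\infty,+\infty]$, and $$w_n(x_1,\dots,x_n)=n^2I(\mu_0)-\frac n2\log n+\frac1\pi W(\nabla H_n',\mathbf 1_{\mathbb{R}^2})+2n\sum_{i=1}^n\zeta(x_i),$$ both sides being $+\infty$ if two of the points coincide. Equivalently, for $F_n(\nu)=\frac1n\big(\frac1\pi W(\nabla H_n',\mathbf 1_{\mathbb{R}^2})+2n\int\zeta\,d\nu\big)$ with $\nu=\sum_{i=1}^n\delta_{x_i}$, $$F_n(\nu)=\frac1{n\pi}W(\nabla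 H_n',\mathbf 1_{\mathbb{R}^2})+2\sum_{i=1}^n\zeta(x_i)=\frac1n\Big(w_n(x_1,\dots,x_n)-n^2I(\mu_0)+\frac n2\log n\Big).$$ -/

import Mathlib

open MeasureTheory Filter Topology
open scoped ENNReal

noncomputable section

namespace CoulombGas

/-! Throughout, the plane `ℝ²` is identified with `ℂ` (Euclidean norm, Lebesgue measure,
real inner product). -/

/-- The kernel `-log |x - y|`, with value `+∞` on the diagonal. -/
def negLog (x y : ℂ) : EReal := -ENNReal.log (edist x y)

/-- The logarithmic energy `∫∫ -log |x - y| dμ(x) dμ(y)` (positive part minus negative part),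
which may be `+∞`; in particular it is `+∞` if `μ` has an atom. -/
def logEnergy (μ : Measure ℂ) : EReal :=
  ((∫⁻ p : ℂ × ℂ, (negLog p.1 p.2).toENNReal ∂(μ.prod μ) : ℝ≥0∞) : EReal)
    - ((∫⁻ p : ℂ × ℂ, (-negLog p.1 p.2).toENNReal ∂(μ.prod μ) : ℝ≥0∞) : EReal)

open Classical in
/-- `I(μ) = ∫∫ -log |x - y| dμ(x) dμ(y) + ∫ V dμ`, with value `+∞` if `V` is not
`μ`-integrable. (The potentials considered here are bounded below, and their growth makes
`log (1 + |x|)` integrable as soon as `V` is, so that no `∞ - ∞` occurs.) -/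
def weightedEnergy (V : ℂ → ℝ) (μ : Measure ℂ) : EReal :=
  if Integrable V μ then logEnergy μ + ((∫ x, V x ∂μ : ℝ) : EReal) else ⊤

/-- `μ₀` is an equilibrium measure for `V`: it minimizes `I` among probability measures. -/
structure IsEquilibriumMeasure (V : ℂ → ℝ) (μ₀ : Measure ℂ) : Prop where
  isProbabilityMeasure : IsProbabilityMeasure μ₀
  energy_le : ∀ μ : Measure ℂ, IsProbabilityMeasure μ →
    weightedEnergy V μ₀ ≤ weightedEnergy V μ

/-- A set has zero logarithmic capacity if every probability measure carried by a compact subset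
of it has infinite logarithmic energy. -/
def HasZeroCapacity (S : Set ℂ) : Prop :=
  ∀ K : Set ℂ, K ⊆ S → IsCompact K →
    ∀ σ : Measure ℂ, IsProbabilityMeasure σ → σ Kᶜ = 0 → logEnergy σ = ⊤

/-- The logarithmic potential `U^μ(x) = -∫ log |x - y| dμ(y)`, that is `-2π Δ⁻¹ μ`. -/
def logPotential (μ : Measure ℂ) (x : ℂ) : ℝ := -∫ y, Real.log ‖x - y‖ ∂μ

/-- `c` is the constant in the Euler-Lagrange conditions of the equilibrium measure:
quasi-everywhere, `U^{μ₀} + V / 2 ≥ c`, with equality on the support of `μ₀`. -/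
def IsEquilibriumConstant (V : ℂ → ℝ) (μ₀ : Measure ℂ) (c : ℝ) : Prop :=
  HasZeroCapacity {x | ¬ c ≤ logPotential μ₀ x + V x / 2} ∧
  HasZeroCapacity {x | x ∈ μ₀.support ∧ ¬ logPotential μ₀ x + V x / 2 = c}

/-- `ζ = U^{μ₀} + V / 2 - c`. -/
def zeta (V : ℂ → ℝ) (μ₀ : Measure ℂ) (c : ℝ) (x : ℂ) : ℝ :=
  logPotential μ₀ x + V x / 2 - c

/-- The Hamiltonian `w_n(x₁, …, x_n) = -∑_{i ≠ j} log |x_i - x_j| + n ∑ V(x_i)`, equal to `+∞`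
if two of the points coincide. -/
def hamiltonian (V : ℂ → ℝ) {n : ℕ} (x : Fin n → ℂ) : EReal :=
  (∑ i, ∑ j ∈ Finset.univ.erase i, negLog (x i) (x j)) + ((n * ∑ i, V (x i) : ℝ) : EReal)

/-- The measure `∑ᵢ δ_{x_i}`. -/
def pointMeasure {n : ℕ} (x : Fin n → ℂ) : Measure ℂ := ∑ i, Measure.dirac (x i)

/-- The image of a point measure under the blow-up `x ↦ x' = √n x`. -/
def blowUpPoints (n : ℕ) (ν : Measure ℂ) : Measure ℂ := ν.map (fun x => √(n : ℝ) • x)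

/-- The blown-up background `dμ₀'(x') = m₀(x' / √n) dx'`, where `m₀` is the Lebesgue density
of `μ₀`. -/
def blowUpBackground (n : ℕ) (μ₀ : Measure ℂ) : Measure ℂ :=
  volume.withDensity (fun x' => μ₀.rnDeriv volume ((√(n : ℝ))⁻¹ • x'))

/-- The potential `H'_n = -2π Δ⁻¹ (ν' - μ₀')`, where `ν'` is the blow-up of `ν`. -/
def blownUpPotential (n : ℕ) (μ₀ ν : Measure ℂ) (x' : ℂ) : ℝ :=
  logPotential (blowUpPoints n ν) x' - logPotential (blowUpBackground n μ₀) x'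

/-- For a point measure `ν'` and a vector field `E`, the quantity
`(1/2) ∫_{ℝ² ∖ ⋃_p B(p, η)} |E|² + π ν'(ℝ²) log η`, the union being over the atoms `p` of `ν'`. -/
def truncatedEnergy (ν' : Measure ℂ) (E : ℂ → ℂ) (η : ℝ) : EReal :=
  ((2⁻¹ * ∫⁻ x in (⋃ p ∈ {p : ℂ | ν' {p} ≠ 0}, Metric.ball p η)ᶜ, ‖E x‖ₑ ^ 2 : ℝ≥0∞) : EReal)
    + ((Real.pi * ν'.real Set.univ * Real.log η : ℝ) : EReal)

/-- The renormalized energy `W(E, 𝟏_{ℝ²})`: the limit of the truncated energies as `η → 0⁺`. -/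
def renormalizedEnergy (ν' : Measure ℂ) (E : ℂ → ℂ) : EReal :=
  limUnder (𝓝[>] (0 : ℝ)) (truncatedEnergy ν' E)

/-- `W(∇H'_n, 𝟏_{ℝ²})` for the charges `ν`. -/
def blownUpEnergy (n : ℕ) (μ₀ ν : Measure ℂ) : EReal :=
  renormalizedEnergy (blowUpPoints n ν) (gradient (blownUpPotential n μ₀ ν))

open Classical in
/-- `F_n(ν) = (1/n) ((1/π) W(∇H'_n, 𝟏_{ℝ²}) + 2n ∫ ζ dν)` if `ν` is a sum of `n` Dirac masses, and
`F_n(ν) = +∞` otherwise. -/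
def nextOrderEnergy (V : ℂ → ℝ) (μ₀ : Measure ℂ) (c : ℝ) (n : ℕ) (ν : Measure ℂ) : EReal :=
  if ∃ x : Fin n → ℂ, ν = pointMeasure x then
    ((1 / n : ℝ) : EReal) * (((1 / Real.pi : ℝ) : EReal) * blownUpEnergy n μ₀ ν
      + ((2 * n * ∫ x, zeta V μ₀ c x ∂ν : ℝ) : EReal))
  else ⊤

end CoulombGas

end

/-! ### The Coulomb field and the pair interaction: decay and integrability -/

noncomputable section

namespace CoulombGas

/-! The renormalized energy is the Coulomb energy of the charges `x_i'` against the background `μ₀'`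
with the infinite self-energies removed, and the formula follows by expanding that energy and using
the Euler-Lagrange equation of `μ₀`.

For two unit charges, `∇log|x - a| · ∇log|x - b|` decays only like `|x|⁻²` and is not integrable.
After subtraction of one fixed tail `|x|⁻² 𝟏_{|x| ≥ 1}` its integral is `-2π log|a - b|`
(`integral_pairKernel`): translate `b` to the origin and use polar coordinates; by Cauchy's formula
the circle of radius `r` contributes only if it encloses the other charge. Fubini extends this to
charge distributions (`integral_inner_chargeField`). When `|∇H'|²` is expanded, the tails occur with
total coefficient `n² - 2n·n + n² = 0`, because background and points have the same mass. The
self-interaction of a point is split at a small radius `δ`: its core, cut off at `η`, gives `2π (log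
δ - log η)`, and half of this cancels the share `π log η` of that point. Thus for distinct points
the limit is `π` times `interactionEnergy`. If points coincide, more than `n` pairs carry a core,
and the surplus of `-log η` drives the limit to `+∞` (`tendsto_truncated_totalField`).

These computations need `μ₀` to be compactly supported with bounded density
(`exists_le_smul_volume`). Comparing `μ₀` with `(1 - t) μ₀ + t σ`, `σ` uniform on a circle about
`x`, gives a mean-value inequality in which `log|x - y|` becomes `max (log r) (log|x - y|)`. As `r →
0` it yields `U + V/2 ≥ c` with `c = I(μ₀) - ½ ∫ V dμ₀`, and integration against `μ₀` forces
equality `μ₀`-almost everywhere. At a point of equality, the same inequality at radius `2r` gives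
`μ₀(B(x, r)) = O(r²)`, since a second-order Taylor expansion bounds the circle means of `V`; a
covering argument turns this into a density bound. The growth of `V` bounds the set of equality.

Finally, blowing up by `√n` adds `½ log n` to every logarithm, with net coefficient `n`
(`interactionEnergy_blowUp`), and `U = ζ + c - V/2` at the points turns the interaction energy into
`w_n`. -/

/-- The gradient `z / |z|²` of `log |z|`. -/
def fieldKernel (z : ℂ) : ℂ := (starRingEnd ℂ z)⁻¹

@[simp] lemma norm_fieldKernel (z : ℂ) : ‖fieldKernel z‖ = ‖z‖⁻¹ := by
  simp [fieldKernel]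

lemma measurable_fieldKernel : Measurable fieldKernel := by
  unfold fieldKernel
  exact (Complex.continuous_conj.measurable).inv

/-- The cut-off `|x|⁻² 𝟏_{|x| ≥ 1}` of the squared kernel. -/
def tailKernel (x : ℂ) : ℝ := if 1 ≤ ‖x‖ then (‖x‖ ^ 2)⁻¹ else 0

lemma measurable_tailKernel : Measurable tailKernel := by
  unfold tailKernel
  exact Measurable.ite (measurableSet_le measurable_const measurable_norm) (by fun_prop)
    measurable_const

lemma tailKernel_nonneg (x : ℂ) : 0 ≤ tailKernel x := by
  unfold tailKernel; split_ifs <;> positivity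

lemma tailKernel_le_one (x : ℂ) : tailKernel x ≤ 1 := by
  unfold tailKernel
  split_ifs with h
  · exact inv_le_one_of_one_le₀ (one_le_pow₀ h)
  · norm_num

lemma tailKernel_neg (x : ℂ) : tailKernel (-x) = tailKernel x := by simp [tailKernel]

lemma inner_fieldKernel_self (z : ℂ) :
    inner ℝ (fieldKernel z) (fieldKernel z) = (‖z‖ ^ 2)⁻¹ := by
  rw [real_inner_self_eq_norm_sq, norm_fieldKernel, inv_pow]

lemma tailKernel_eq_inner {z : ℂ} (hz : 1 ≤ ‖z‖) :
    tailKernel z = inner ℝ (fieldKernel z) (fieldKernel z) := by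
  rw [inner_fieldKernel_self, tailKernel, if_pos hz]

/-- The interaction `∇log |x - a| · ∇log |x - b|`, made integrable at infinity. -/
def pairKernel (a b x : ℂ) : ℝ :=
  inner ℝ (fieldKernel (x - a)) (fieldKernel (x - b)) - tailKernel x

lemma measurable_pairKernel (a b : ℂ) : Measurable (pairKernel a b) := by
  unfold pairKernel
  exact ((measurable_fieldKernel.comp (by fun_prop)).inner
    (measurable_fieldKernel.comp (by fun_prop))).sub measurable_tailKernel

/-- The difference of two inverses is a product of both with `conj a`, so moving the charge costs
one extra power of `|x|` at infinity. -/
lemma norm_fieldKernel_sub_sub {ρ : ℝ} (hρ : 1 ≤ ρ) {a x : ℂ} (ha : ‖a‖ ≤ ρ) (hx : 2 * ρ < ‖x‖) :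
    ‖fieldKernel (x - a)‖ ≤ 2 / ‖x‖ ∧
      ‖fieldKernel (x - a) - fieldKernel x‖ ≤ 2 * ρ / ‖x‖ ^ 2 := by
  have hxpos : 0 < ‖x‖ := by linarith
  have h1 : ‖x‖ / 2 ≤ ‖x - a‖ := by
    have := norm_sub_norm_le x a
    linarith
  have hxa : 0 < ‖x - a‖ := by linarith
  have h2 : ‖fieldKernel (x - a)‖ ≤ 2 / ‖x‖ := by
    rw [norm_fieldKernel, inv_le_comm₀ hxa (by positivity)]
    simpa using h1
  refine ⟨h2, ?_⟩
  have hx0 : x ≠ 0 := norm_pos_iff.1 hxpos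
  have hxa0 : x - a ≠ 0 := norm_pos_iff.1 hxa
  have : fieldKernel (x - a) - fieldKernel x
      = fieldKernel (x - a) * (starRingEnd ℂ a) * fieldKernel x := by
    have e1 : starRingEnd ℂ x ≠ 0 := by simpa using hx0
    have e2 : starRingEnd ℂ (x - a) ≠ 0 := (map_ne_zero _).2 hxa0
    unfold fieldKernel
    rw [inv_sub_inv e2 e1, map_sub]
    field_simp
    ring
  rw [this, norm_mul, norm_mul, norm_fieldKernel x, RCLike.norm_conj]
  calc ‖fieldKernel (x - a)‖ * ‖a‖ * ‖x‖⁻¹ ≤ 2 / ‖x‖ * ρ * ‖x‖⁻¹ := by gcongr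
    _ = 2 * ρ / ‖x‖ ^ 2 := by field_simp

/-- An integrable majorant of `pairKernel`. -/
def pairMajorant (ρ : ℝ) (a b x : ℂ) : ℝ :=
  (Metric.closedBall (0 : ℂ) (2 * ρ)).indicator
    (fun x => ‖fieldKernel (x - a)‖ * ‖fieldKernel (x - b)‖ + 1) x
    + 48 * ρ * (1 + ‖x‖) ^ (-3 : ℝ)

lemma integrable_one_add_norm_rpow_neg_three :
    Integrable (fun x : ℂ => (1 + ‖x‖) ^ (-3 : ℝ)) := by
  apply integrable_one_add_norm
  rw [Complex.finrank_real_complex]; norm_num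

/-- Far away the tail is `fieldKernel x` paired with itself. Telescoping through it leaves two
terms, each containing a difference of kernels, hence `O(|x|⁻³)`, which is integrable in the plane.
The far bound is uniform in the charges, as Fubini later requires. -/
lemma abs_pairKernel_le {ρ : ℝ} (hρ : 1 ≤ ρ) {a b : ℂ} (ha : ‖a‖ ≤ ρ) (hb : ‖b‖ ≤ ρ) (x : ℂ) :
    |pairKernel a b x| ≤ pairMajorant ρ a b x := by
  unfold pairMajorant
  have hJ : 0 ≤ 48 * ρ * (1 + ‖x‖) ^ (-3 : ℝ) := by positivity
  by_cases hx : x ∈ Metric.closedBall (0 : ℂ) (2 * ρ)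
  · rw [Set.indicator_of_mem hx]
    have h1 := abs_real_inner_le_norm (fieldKernel (x - a)) (fieldKernel (x - b))
    have h2 : |pairKernel a b x| ≤
        |inner ℝ (fieldKernel (x - a)) (fieldKernel (x - b))| + |tailKernel x| := abs_sub _ _
    rw [abs_of_nonneg (tailKernel_nonneg x)] at h2
    have := tailKernel_le_one x
    linarith
  · rw [Set.indicator_of_notMem hx, zero_add]
    have hx' : 2 * ρ < ‖x‖ := by simpa using hx
    obtain ⟨-, ha2⟩ := norm_fieldKernel_sub_sub hρ ha hx'
    obtain ⟨hb1, hb2⟩ := norm_fieldKernel_sub_sub hρ hb hx'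
    have hxpos : 0 < ‖x‖ := by linarith
    have e : pairKernel a b x =
        inner ℝ (fieldKernel (x - a) - fieldKernel x) (fieldKernel (x - b))
        + inner ℝ (fieldKernel x) (fieldKernel (x - b) - fieldKernel x) := by
      rw [pairKernel, tailKernel_eq_inner (by linarith), inner_sub_left, inner_sub_right]; ring
    have e3 : (1 + ‖x‖) ^ (-3 : ℝ) = ((1 + ‖x‖) ^ 3)⁻¹ := by
      rw [Real.rpow_neg (by positivity)]; norm_cast
    rw [e, e3]
    calc _ ≤ ‖fieldKernel (x - a) - fieldKernel x‖ * ‖fieldKernel (x - b)‖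
          + ‖fieldKernel x‖ * ‖fieldKernel (x - b) - fieldKernel x‖ :=
        (abs_add_le _ _).trans (add_le_add (abs_real_inner_le_norm _ _)
          (abs_real_inner_le_norm _ _))
      _ ≤ (2 * ρ / ‖x‖ ^ 2) * (2 / ‖x‖) + ‖x‖⁻¹ * (2 * ρ / ‖x‖ ^ 2) := by
        rw [norm_fieldKernel x]; gcongr
      -- The sum is `6ρ / |x|³`, and `48 = 6 · 2³`; the factor `2` absorbs `1 + |x| ≤ 2|x|`.
      _ = 48 * ρ * ((2 * ‖x‖) ^ 3)⁻¹ := by field_simp; norm_num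
      _ ≤ 48 * ρ * ((1 + ‖x‖) ^ 3)⁻¹ := by gcongr; linarith

lemma integrableOn_norm_fieldKernel_ball (r : ℝ) :
    IntegrableOn (fun x : ℂ => ‖fieldKernel x‖) (Metric.ball 0 r) := by
  simp only [norm_fieldKernel]
  rw [integrableOn_fun_norm_addHaar volume (f := fun t : ℝ => t⁻¹), Complex.finrank_real_complex]
  refine (integrableOn_const (C := (1:ℝ)) (by simp) (by simp)).congr_fun ?_ measurableSet_Ioo
  intro y hy
  have : y ≠ 0 := hy.1.ne'
  simp [this]

lemma integrableOn_norm_fieldKernel_sub (a : ℂ) (r : ℝ) :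
    IntegrableOn (fun x : ℂ => ‖fieldKernel (x - a)‖) (Metric.closedBall 0 r) := by
  have h := (integrableOn_norm_fieldKernel_ball (r + ‖a‖ + 1))
  rw [← integrable_indicator_iff measurableSet_ball] at h
  have h2 := (h.comp_sub_right a).integrableOn (s := Metric.closedBall 0 r)
  refine h2.congr_fun (fun x hx => ?_) measurableSet_closedBall
  beta_reduce
  rw [Set.indicator_of_mem]
  have := norm_sub_le x a
  simp only [Metric.mem_closedBall, dist_zero_right] at hx
  simp only [Metric.mem_ball, dist_zero_right]
  linarith

/-- A partial-fraction bound: since `|a - b| ≤ |x - a| + |x - b|`, the product has only the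
separate, locally integrable singularities. -/
lemma norm_fieldKernel_mul_le {a b : ℂ} (hab : a ≠ b) (x : ℂ) :
    ‖fieldKernel (x - a)‖ * ‖fieldKernel (x - b)‖
      ≤ ‖a - b‖⁻¹ * (‖fieldKernel (x - a)‖ + ‖fieldKernel (x - b)‖) := by
  simp only [norm_fieldKernel]
  have hd : 0 < ‖a - b‖ := norm_pos_iff.2 (sub_ne_zero.2 hab)
  rcases eq_or_ne x a with rfl | hxa
  · simp; positivity
  rcases eq_or_ne x b with rfl | hxb
  · simp; positivity
  have h1 : 0 < ‖x - a‖ := norm_pos_iff.2 (sub_ne_zero.2 hxa)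
  have h2 : 0 < ‖x - b‖ := norm_pos_iff.2 (sub_ne_zero.2 hxb)
  have h3 : ‖a - b‖ ≤ ‖x - b‖ + ‖x - a‖ := by
    have := norm_sub_le (x - b) (x - a)
    simpa using this
  rw [inv_mul_eq_div ‖a - b‖, le_div_iff₀ hd]
  calc ‖x - a‖⁻¹ * ‖x - b‖⁻¹ * ‖a - b‖ ≤ ‖x - a‖⁻¹ * ‖x - b‖⁻¹ * (‖x - b‖ + ‖x - a‖) := by gcongr
    _ = _ := by field_simp

lemma integrable_pairKernel {a b : ℂ} (hab : a ≠ b) : Integrable (pairKernel a b) := by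
  set ρ := max 1 (max ‖a‖ ‖b‖)
  have hρ : 1 ≤ ρ := le_max_left _ _
  have ha : ‖a‖ ≤ ρ := (le_max_left _ _).trans (le_max_right _ _)
  have hb : ‖b‖ ≤ ρ := (le_max_right _ _).trans (le_max_right _ _)
  have hmaj : Integrable (pairMajorant ρ a b) := by
    refine Integrable.add ?_ (integrable_one_add_norm_rpow_neg_three.const_mul _)
    rw [integrable_indicator_iff measurableSet_closedBall]
    refine Integrable.add ?_ (integrableOn_const (isCompact_closedBall _ _).measure_ne_top (by simp))
    refine Integrable.mono' (((integrableOn_norm_fieldKernel_sub a _).add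
      (integrableOn_norm_fieldKernel_sub b _)).const_mul ‖a - b‖⁻¹) ?_ ?_
    · exact ((measurable_fieldKernel.comp (by fun_prop)).norm.mul
        (measurable_fieldKernel.comp (by fun_prop)).norm).aestronglyMeasurable
    · refine ae_of_all _ fun x => ?_
      rw [Real.norm_of_nonneg (by positivity)]
      exact norm_fieldKernel_mul_le hab x
  exact hmaj.mono' (measurable_pairKernel a b).aestronglyMeasurable
    (ae_of_all _ (abs_pairKernel_le hρ ha hb))

lemma integrable_tailKernel_sub (b : ℂ) :
    Integrable (fun x => tailKernel (x - b) - tailKernel x) := by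
  set ρ := max 1 ‖b‖
  have hρ : 1 ≤ ρ := le_max_left _ _
  have hb : ‖b‖ ≤ ρ := le_max_right _ _
  have hmaj : Integrable (fun x : ℂ => (Metric.closedBall (0 : ℂ) (2 * ρ)).indicator 1 x
      + 48 * ρ * (1 + ‖x‖) ^ (-3 : ℝ)) := by
    refine Integrable.add ?_ (integrable_one_add_norm_rpow_neg_three.const_mul _)
    rw [integrable_indicator_iff measurableSet_closedBall]
    exact integrableOn_const (isCompact_closedBall _ _).measure_ne_top (by simp)
  refine hmaj.mono' ((measurable_tailKernel.comp (by fun_prop)).sub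
    measurable_tailKernel).aestronglyMeasurable (ae_of_all _ fun x => ?_)
  rw [Real.norm_eq_abs]
  by_cases hx : x ∈ Metric.closedBall (0 : ℂ) (2 * ρ)
  · have hJ : 0 ≤ 48 * ρ * (1 + ‖x‖) ^ (-3 : ℝ) := by positivity
    have h1 : |tailKernel (x - b) - tailKernel x| ≤ 1 := by
      rw [abs_le]
      constructor <;> linarith [tailKernel_nonneg x, tailKernel_le_one x,
        tailKernel_nonneg (x - b), tailKernel_le_one (x - b)]
    rw [Set.indicator_of_mem hx, Pi.one_apply]
    linarith
  · have h := abs_pairKernel_le hρ hb hb x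
    have hx' : 2 * ρ < ‖x‖ := by simpa using hx
    rw [pairMajorant, Set.indicator_of_notMem hx] at h
    rw [Set.indicator_of_notMem hx]
    rwa [tailKernel_eq_inner (z := x - b)]
    linarith [norm_sub_norm_le x b]

/-- The tail alone is not integrable, so translation invariance cannot be applied to the two terms
separately. Recentred at `b / 2`, the difference is odd under `x ↦ -x`. -/
lemma integral_tailKernel_sub (b : ℂ) : ∫ x, (tailKernel (x - b) - tailKernel x) = 0 := by
  have h1 : ∫ x, (tailKernel (x - b) - tailKernel x)
      = ∫ x, (tailKernel (x - b / 2) - tailKernel (x + b / 2)) := by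
    rw [← integral_add_right_eq_self _ (b / 2)]
    congr 1 with x
    congr 2; ring
  have h2 : ∫ x, (tailKernel (x - b / 2) - tailKernel (x + b / 2))
      = - ∫ x, (tailKernel (x - b / 2) - tailKernel (x + b / 2)) := by
    conv_lhs => rw [← integral_neg_eq_self]
    rw [← integral_neg]
    congr 1 with x
    rw [← tailKernel_neg (-x - b / 2), ← tailKernel_neg (-x + b / 2)]
    rw [show -(-x - b / 2) = x + b / 2 by ring, show -(-x + b / 2) = x - b / 2 by ring]; ring
  rw [h1]; linarith

end CoulombGas

end

/-! ### Evaluation of the pair interaction by circle averages -/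

noncomputable section

namespace CoulombGas

lemma setIntegral_Ioo_circleMap (f : ℂ → ℝ) (c : ℂ) (r : ℝ) :
    ∫ θ in Set.Ioo (-Real.pi) Real.pi, f (circleMap c r θ)
      = 2 * Real.pi * Real.circleAverage f c r := by
  have hp : Function.Periodic (fun θ => f (circleMap c r θ)) (2 * Real.pi) := fun θ => by
    simp [periodic_circleMap c r θ]
  have h := hp.intervalIntegral_add_eq 0 (-Real.pi)
  rw [zero_add, show -Real.pi + 2 * Real.pi = Real.pi by ring] at h
  rw [Real.circleAverage, h, smul_eq_mul, mul_inv_cancel_left₀ (by positivity),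
    intervalIntegral.integral_of_le (by linarith [Real.pi_pos]), integral_Ioc_eq_integral_Ioo]

/-- The factor `z` cancels the `z⁻¹` of the averaging measure and leaves `(2πi)⁻¹ ∮ dz / (z - d)`,
the winding number about `d`. -/
lemma circleAverage_mul_inv_sub {d : ℂ} {r : ℝ} (hr : 0 < r) (hd : ‖d‖ ≠ r) :
    Real.circleAverage (fun z => z * (z - d)⁻¹) 0 r = if ‖d‖ < r then 1 else 0 := by
  rw [Real.circleAverage_eq_circleIntegral hr.ne']
  have e : (∮ z in C(0, r), (z - 0)⁻¹ • (z * (z - d)⁻¹)) = ∮ z in C(0, r), (z - d)⁻¹ := by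
    refine circleIntegral.integral_congr hr.le fun z hz => ?_
    have hz0 : z ≠ 0 := by
      rintro rfl
      simp at hz
      exact hr.ne hz
    simp [hz0]
  rw [e]
  split_ifs with h
  · rw [circleIntegral.integral_sub_inv_of_mem_ball (by simpa using h), smul_eq_mul,
      inv_mul_cancel₀ Complex.two_pi_I_ne_zero]
  · have hlt : r < ‖d‖ := lt_of_le_of_ne (not_lt.1 h) (Ne.symm hd)
    rw [DiffContOnCl.circleIntegral_eq_zero hr.le, smul_zero]
    refine DifferentiableOn.diffContOnCl fun z hz => ?_
    have hzd : z - d ≠ 0 := by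
      rw [sub_ne_zero]
      rintro rfl
      have := Metric.closure_ball_subset_closedBall hz
      simp at this
      linarith
    exact ((differentiableAt_id.sub_const d).inv hzd).differentiableWithinAt

lemma circleIntegrable_mul_inv_sub {d : ℂ} {r : ℝ} (hr : 0 < r) (hd : ‖d‖ ≠ r) :
    CircleIntegrable (fun z => z * (z - d)⁻¹) 0 r := by
  refine ContinuousOn.circleIntegrable hr.le ?_
  refine continuousOn_id.mul (ContinuousOn.inv₀ (by fun_prop) fun z hz => ?_)
  rw [sub_ne_zero]
  rintro rfl
  simp at hz
  exact hd hz

/-- On the circle `conj z = r² / z`, so the scalar product is `r⁻² Re (z / (z - d))`. -/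
lemma circleAverage_pairKernel_zero {d : ℂ} {r : ℝ} (hr : 0 < r) (hd : ‖d‖ ≠ r) :
    Real.circleAverage (pairKernel d 0) 0 r
      = (r ^ 2)⁻¹ * ((if ‖d‖ < r then 1 else 0) - if 1 ≤ r then 1 else 0) := by
  have e : Set.EqOn (pairKernel d 0)
      (fun z => (r ^ 2)⁻¹ • (z * (z - d)⁻¹).re - (r ^ 2)⁻¹ * if 1 ≤ r then 1 else 0)
      (Metric.sphere 0 |r|) := by
    intro z hz
    have hz' : ‖z‖ = r := by simpa [abs_of_pos hr] using hz
    have hz0 : z ≠ 0 := by rintro rfl; simp at hz'; exact hr.ne hz'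
    have h1 : (starRingEnd ℂ z)⁻¹ = z * (((r ^ 2)⁻¹ : ℝ) : ℂ) := by
      rw [Complex.inv_def, Complex.conj_conj, Complex.normSq_conj, Complex.normSq_eq_norm_sq, hz']
    have h2 : inner ℝ (fieldKernel (z - d)) (fieldKernel (z - 0))
        = (r ^ 2)⁻¹ • (z * (z - d)⁻¹).re := by
      rw [Complex.inner, fieldKernel, fieldKernel, sub_zero, map_inv₀, Complex.conj_conj, h1,
        mul_right_comm, Complex.re_mul_ofReal, smul_eq_mul, mul_comm]
    simp only [pairKernel, h2, tailKernel, hz']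
    split_ifs <;> simp
  rw [Real.circleAverage_congr_sphere e]
  have hI := circleIntegrable_mul_inv_sub hr hd
  have hre : CircleIntegrable (fun z => (z * (z - d)⁻¹).re) 0 r := by
    exact ⟨Complex.reCLM.integrable_comp hI.1, Complex.reCLM.integrable_comp hI.2⟩
  rw [Real.circleAverage_fun_sub (hre.const_fun_smul) (circleIntegrable_const _ _ _),
    Real.circleAverage_fun_smul, Real.circleAverage_const]
  have := Complex.reCLM.circleAverage_comp_comm hI
  simp only [Function.comp_def, Complex.reCLM_apply, circleAverage_mul_inv_sub hr hd] at this
  rw [this, smul_eq_mul, mul_sub]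
  split_ifs <;> simp

lemma integral_inv_indicator_sub {d : ℝ} (hd : 0 < d) :
    ∫ r in Set.Ioi (0 : ℝ), r⁻¹ * ((if d < r then (1 : ℝ) else 0) - if 1 < r then 1 else 0)
      = -Real.log d := by
  have e : Set.EqOn
      (fun r : ℝ => r⁻¹ * ((if d < r then (1 : ℝ) else 0) - if 1 < r then 1 else 0))
      (fun r => (Set.Ioc d 1).indicator (fun r => r⁻¹) r - (Set.Ioc 1 d).indicator (fun r => r⁻¹) r)
      (Set.Ioi 0) := by
    intro r hr
    simp only [Set.indicator, Set.mem_Ioc]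
    by_cases h1 : d < r <;> by_cases h2 : 1 < r <;>
      simp [h1, h2, not_lt.1, not_le.2]
  have hint : ∀ {a b : ℝ}, 0 < a → Integrable ((Set.Ioc a b).indicator fun r => r⁻¹)
      (volume.restrict (Set.Ioi 0)) := by
    intro a b ha
    refine Integrable.restrict ?_
    rw [integrable_indicator_iff measurableSet_Ioc]
    refine IntegrableOn.mono_set (ContinuousOn.integrableOn_Icc (a := a) (b := b)
      (continuousOn_inv₀.mono fun x hx => ?_)) Set.Ioc_subset_Icc_self
    exact (ha.trans_le hx.1).ne'
  rw [setIntegral_congr_fun measurableSet_Ioi e, integral_sub (hint hd) (hint one_pos),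
    setIntegral_indicator measurableSet_Ioc, setIntegral_indicator measurableSet_Ioc,
    Set.inter_eq_right.2 (show Set.Ioc d 1 ⊆ Set.Ioi 0 from fun x hx => hd.trans hx.1),
    Set.inter_eq_right.2
      (show Set.Ioc 1 d ⊆ Set.Ioi 0 from fun x hx => (zero_lt_one' ℝ).trans hx.1)]
  -- The oriented integral is by definition the difference of the two `Ioc` integrals, so `d ≤ 1`
  -- and `d > 1` need no separate treatment.
  change (∫ x in d..1, x⁻¹) = _
  rw [integral_inv_of_pos hd one_pos, one_div, Real.log_inv]

lemma integral_pairKernel_zero {d : ℂ} (hd : d ≠ 0) :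
    ∫ x, pairKernel d 0 x = -(2 * Real.pi * Real.log ‖d‖) := by
  have hi := integrable_pairKernel hd
  have hpol : IntegrableOn (fun p : ℝ × ℝ => p.1 • pairKernel d 0 (Complex.polarCoord.symm p))
      (Set.Ioi 0 ×ˢ Set.Ioo (-Real.pi) Real.pi) (volume.prod volume) := by
    rw [← Measure.volume_eq_prod, ← Complex.polarCoord_target]
    refine ⟨?_, ?_⟩
    · refine (measurable_fst.smul ((measurable_pairKernel d 0).comp ?_)).aestronglyMeasurable
      rw [show (Complex.polarCoord.symm : ℝ × ℝ → ℂ) = _ from funext Complex.polarCoord_symm_apply]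
      fun_prop
    · have h := hi.2
      rw [HasFiniteIntegral, ← Complex.lintegral_comp_polarCoord_symm] at h
      refine lt_of_le_of_lt (le_of_eq ?_) h
      refine setLIntegral_congr_fun Complex.polarCoord.open_target.measurableSet fun p hp => ?_
      have : 0 < p.1 := by rw [Complex.polarCoord_target] at hp; exact hp.1
      simp only [smul_eq_mul, enorm_mul, Real.enorm_of_nonneg this.le]
  rw [← Complex.integral_comp_polarCoord_symm,
    show polarCoord.target = Set.Ioi 0 ×ˢ Set.Ioo (-Real.pi) Real.pi from rfl, Measure.volume_eq_prod,
    setIntegral_prod _ hpol]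
  have hd' : 0 < ‖d‖ := norm_pos_iff.2 hd
  rw [show -(2 * Real.pi * Real.log ‖d‖) = 2 * Real.pi * -Real.log ‖d‖ by ring,
    ← integral_inv_indicator_sub hd', ← integral_const_mul]
  refine setIntegral_congr_ae measurableSet_Ioi ?_
  -- Two radii are discarded: at `‖d‖` the circle meets the pole, and at `1` the strict and
  -- non-strict cut-offs differ.
  have h1 : ∀ᵐ r : ℝ, r ≠ ‖d‖ := by simp [ae_iff]
  have h2 : ∀ᵐ r : ℝ, r ≠ 1 := by simp [ae_iff]
  filter_upwards [h1, h2] with r hr1 hr2 hr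
  have hr : 0 < r := hr
  have e1 : ∀ θ : ℝ, Complex.polarCoord.symm (r, θ) = circleMap 0 r θ := by
    intro θ
    simp [Complex.polarCoord_symm_apply, circleMap, Complex.exp_mul_I]
  simp only [e1]
  rw [integral_smul, setIntegral_Ioo_circleMap, circleAverage_pairKernel_zero hr hr1.symm]
  have : (1 < r) = (1 ≤ r) := by
    rw [eq_iff_iff]; exact ⟨le_of_lt, fun h => lt_of_le_of_ne h (Ne.symm hr2)⟩
  simp only [this, smul_eq_mul]
  field_simp

/-- The regularized interaction of two unit charges. -/
lemma integral_pairKernel {a b : ℂ} (hab : a ≠ b) :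
    ∫ x, pairKernel a b x = -(2 * Real.pi * Real.log ‖a - b‖) := by
  have hd : a - b ≠ 0 := sub_ne_zero.2 hab
  have e : ∀ x, pairKernel a b x
      = pairKernel (a - b) 0 (x - b) + (tailKernel (x - b) - tailKernel x) := by
    intro x
    simp only [pairKernel]
    rw [show x - b - (a - b) = x - a by ring, sub_zero]
    ring
  simp only [e]
  rw [integral_add ((integrable_pairKernel hd).comp_sub_right b) (integrable_tailKernel_sub b),
    integral_tailKernel_sub, add_zero, integral_sub_right_eq_self (pairKernel (a - b) 0),
    integral_pairKernel_zero hd]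

end CoulombGas

end

/-! ### Interaction of charge distributions; measures of bounded density -/

noncomputable section

namespace CoulombGas

/-- The field `∇ ∫ log |x - y| dμ(y)` generated by a measure. -/
def chargeField (μ : Measure ℂ) (x : ℂ) : ℂ := ∫ y, fieldKernel (x - y) ∂μ

lemma integral_inner_prod {μ₁ μ₂ : Measure ℂ} [IsFiniteMeasure μ₁] [IsFiniteMeasure μ₂]
    {f g : ℂ → ℂ} (hf : Integrable f μ₁) (hg : Integrable g μ₂) :
    Integrable (fun q : ℂ × ℂ => inner ℝ (f q.1) (g q.2)) (μ₁.prod μ₂) ∧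
    ∫ q : ℂ × ℂ, inner ℝ (f q.1) (g q.2) ∂(μ₁.prod μ₂)
      = inner ℝ (∫ x, f x ∂μ₁) (∫ x, g x ∂μ₂) := by
  have hi : Integrable (fun q : ℂ × ℂ => inner ℝ (f q.1) (g q.2)) (μ₁.prod μ₂) := by
    refine (hf.norm.mul_prod hg.norm).mono' ?_ (ae_of_all _ fun q => norm_inner_le_norm _ _)
    exact (hf.aestronglyMeasurable.comp_fst).inner (hg.aestronglyMeasurable.comp_snd)
  refine ⟨hi, ?_⟩
  rw [integral_prod _ hi]
  simp only [integral_inner hg]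
  simp only [real_inner_comm (∫ x, g x ∂μ₂)]
  rw [integral_inner hf]

/-- This is what Fubini needs in `integral_inner_chargeField`. The far part of `pairMajorant`
depends on the charges only through `ρ`; the near part is a product over the two charges, and its
integral factors into `hfin`. -/
lemma integrable_uncurry_pairKernel {μ₁ μ₂ : Measure ℂ} [IsFiniteMeasure μ₁] [IsFiniteMeasure μ₂]
    {ρ : ℝ} (hρ : 1 ≤ ρ) (h₁ : μ₁ (Metric.closedBall 0 ρ)ᶜ = 0)
    (h₂ : μ₂ (Metric.closedBall 0 ρ)ᶜ = 0)
    (hfin : ∫⁻ x in Metric.closedBall 0 (2 * ρ),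
      (∫⁻ y, ‖fieldKernel (x - y)‖ₑ ∂μ₁) * (∫⁻ y, ‖fieldKernel (x - y)‖ₑ ∂μ₂) ≠ ∞) :
    Integrable (fun z : ℂ × ℂ × ℂ => pairKernel z.2.1 z.2.2 z.1)
      (volume.prod (μ₁.prod μ₂)) := by
  have hk : Measurable fun p : ℂ × ℂ => fieldKernel (p.1 - p.2) :=
    measurable_fieldKernel.comp (by fun_prop)
  have hm1 : Measurable fun z : ℂ × ℂ × ℂ => fieldKernel (z.1 - z.2.1) :=
    measurable_fieldKernel.comp (by fun_prop)
  have hm2 : Measurable fun z : ℂ × ℂ × ℂ => fieldKernel (z.1 - z.2.2) :=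
    measurable_fieldKernel.comp (by fun_prop)
  have hB : MeasurableSet ((fun z : ℂ × ℂ × ℂ => z.1) ⁻¹' Metric.closedBall 0 (2 * ρ)) :=
    measurable_fst measurableSet_closedBall
  have hmeas : Measurable fun z : ℂ × ℂ × ℂ => pairKernel z.2.1 z.2.2 z.1 :=
    (hm1.inner hm2).sub (measurable_tailKernel.comp measurable_fst)
  have hA : Integrable (((fun z : ℂ × ℂ × ℂ => z.1) ⁻¹' Metric.closedBall 0 (2 * ρ)).indicator
      fun z => ‖fieldKernel (z.1 - z.2.1)‖ * ‖fieldKernel (z.1 - z.2.2)‖)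
      (volume.prod (μ₁.prod μ₂)) := by
    refine ⟨((hm1.norm.mul hm2.norm).indicator hB).aestronglyMeasurable, ?_⟩
    refine lt_of_le_of_lt (le_of_eq ?_) (lt_top_iff_ne_top.2 hfin)
    have hm : Measurable (((fun z : ℂ × ℂ × ℂ => z.1) ⁻¹' Metric.closedBall 0 (2 * ρ)).indicator
        fun z => ‖fieldKernel (z.1 - z.2.1)‖ * ‖fieldKernel (z.1 - z.2.2)‖) :=
      (hm1.norm.mul hm2.norm).indicator hB
    rw [lintegral_prod _ hm.enorm.aemeasurable, ← lintegral_indicator measurableSet_closedBall]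
    refine lintegral_congr fun x => ?_
    by_cases hx : x ∈ Metric.closedBall (0 : ℂ) (2 * ρ)
    · rw [Set.indicator_of_mem hx, ← lintegral_prod_mul]
      · refine lintegral_congr fun q => ?_
        rw [Set.indicator_of_mem (by exact hx)]
        rw [enorm_mul, enorm_norm, enorm_norm]
      · exact (hk.comp (measurable_const.prodMk measurable_id)).enorm.aemeasurable
      · exact (hk.comp (measurable_const.prodMk measurable_id)).enorm.aemeasurable
    · rw [Set.indicator_of_notMem hx]
      simp only [Set.indicator, Set.mem_preimage, hx, if_false, enorm_zero, lintegral_zero]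
  have hC : Integrable (fun x : ℂ => (Metric.closedBall (0 : ℂ) (2 * ρ)).indicator 1 x
      + 48 * ρ * (1 + ‖x‖) ^ (-3 : ℝ)) := by
    refine Integrable.add ?_ (integrable_one_add_norm_rpow_neg_three.const_mul _)
    rw [integrable_indicator_iff measurableSet_closedBall]
    exact integrableOn_const (isCompact_closedBall _ _).measure_ne_top (by simp)
  refine (hA.add (hC.comp_fst (μ₁.prod μ₂))).mono' hmeas.aestronglyMeasurable ?_
  have ae1 : ∀ᵐ q ∂(μ₁.prod μ₂), ‖q.1‖ ≤ ρ := by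
    refine Measure.quasiMeasurePreserving_fst.ae (p := fun y : ℂ => ‖y‖ ≤ ρ) ?_
    rw [ae_iff]; convert h₁ using 2; ext; simp
  have ae2 : ∀ᵐ q ∂(μ₁.prod μ₂), ‖q.2‖ ≤ ρ := by
    refine Measure.quasiMeasurePreserving_snd.ae (p := fun y : ℂ => ‖y‖ ≤ ρ) ?_
    rw [ae_iff]; convert h₂ using 2; ext; simp
  have ae3 : ∀ᵐ z ∂((volume : Measure ℂ).prod (μ₁.prod μ₂)), ‖z.2.1‖ ≤ ρ ∧ ‖z.2.2‖ ≤ ρ :=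
    Measure.quasiMeasurePreserving_snd.ae (p := fun q : ℂ × ℂ => ‖q.1‖ ≤ ρ ∧ ‖q.2‖ ≤ ρ)
      (ae1.and ae2)
  filter_upwards [ae3] with z hz
  have := abs_pairKernel_le hρ hz.1 hz.2 z.1
  rw [Real.norm_eq_abs]
  refine this.trans (le_of_eq ?_)
  by_cases hx : z.1 ∈ Metric.closedBall (0 : ℂ) (2 * ρ)
  · rw [pairMajorant, Pi.add_apply, Set.indicator_of_mem hx, Set.indicator_of_mem (by exact hx),
      Set.indicator_of_mem hx, Pi.one_apply]
    ring
  · rw [pairMajorant, Pi.add_apply, Set.indicator_of_notMem hx, Set.indicator_of_notMem (by exact hx),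
      Set.indicator_of_notMem hx]
    ring

/-- The regularized interaction of two charge distributions. -/
lemma integral_inner_chargeField {μ₁ μ₂ : Measure ℂ} [IsFiniteMeasure μ₁] [IsFiniteMeasure μ₂]
    {ρ : ℝ} (hρ : 1 ≤ ρ) (h₁ : μ₁ (Metric.closedBall 0 ρ)ᶜ = 0)
    (h₂ : μ₂ (Metric.closedBall 0 ρ)ᶜ = 0)
    (hi₁ : ∀ x, Integrable (fun y => fieldKernel (x - y)) μ₁)
    (hi₂ : ∀ x, Integrable (fun y => fieldKernel (x - y)) μ₂)
    (hne : ∀ᵐ q ∂(μ₁.prod μ₂), q.1 ≠ q.2)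
    (hfin : ∫⁻ x in Metric.closedBall 0 (2 * ρ),
      (∫⁻ y, ‖fieldKernel (x - y)‖ₑ ∂μ₁) * (∫⁻ y, ‖fieldKernel (x - y)‖ₑ ∂μ₂) ≠ ∞) :
    Integrable (fun x => inner ℝ (chargeField μ₁ x) (chargeField μ₂ x)
      - μ₁.real Set.univ * μ₂.real Set.univ * tailKernel x) ∧
    ∫ x, (inner ℝ (chargeField μ₁ x) (chargeField μ₂ x)
      - μ₁.real Set.univ * μ₂.real Set.univ * tailKernel x)
      = -(2 * Real.pi * ∫ q : ℂ × ℂ, Real.log ‖q.1 - q.2‖ ∂(μ₁.prod μ₂)) := by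
  have hI := integrable_uncurry_pairKernel hρ h₁ h₂ hfin
  have e : ∀ x, ∫ q : ℂ × ℂ, pairKernel q.1 q.2 x ∂(μ₁.prod μ₂)
      = inner ℝ (chargeField μ₁ x) (chargeField μ₂ x)
        - μ₁.real Set.univ * μ₂.real Set.univ * tailKernel x := by
    intro x
    obtain ⟨hi, hv⟩ := integral_inner_prod (hi₁ x) (hi₂ x)
    simp only [pairKernel]
    rw [integral_sub hi (integrable_const _), hv, integral_const, smul_eq_mul,
      ← Set.univ_prod_univ, measureReal_prod_prod]
    rfl
  simp only [← e]
  refine ⟨hI.integral_prod_left, ?_⟩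
  rw [integral_integral_swap hI, ← integral_const_mul, ← integral_neg]
  refine integral_congr_ae ?_
  filter_upwards [hne] with q hq
  exact integral_pairKernel hq

lemma ae_prod_ne {μ₁ μ₂ : Measure ℂ} [SFinite μ₂] [NullSingletonClass μ₂] :
    ∀ᵐ q ∂(μ₁.prod μ₂), q.1 ≠ q.2 := by
  have hD : MeasurableSet {q : ℂ × ℂ | q.1 = q.2} := measurableSet_eq_fun measurable_fst measurable_snd
  rw [ae_iff]
  simp only [ne_eq, not_not]
  rw [Measure.measure_prod_null hD]
  refine ae_of_all _ fun x => ?_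
  have : Prod.mk x ⁻¹' {q : ℂ × ℂ | q.1 = q.2} = {x} := by ext; simp [eq_comm]
  beta_reduce
  rw [this, measure_singleton]; rfl

section BoundedDensity

variable {μ : Measure ℂ} {C : NNReal}

lemma noAtoms_of_le_smul_volume (hμ : μ ≤ C • volume) : NullSingletonClass μ :=
  ⟨fun x => le_antisymm ((hμ _).trans (by simp)) bot_le⟩

lemma setLIntegral_fieldKernel_ball_le (hμ : μ ≤ C • volume) (x : ℂ) (δ : ℝ) :
    ∫⁻ y in Metric.ball x δ, ‖fieldKernel (x - y)‖ₑ ∂μ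
      ≤ C * ∫⁻ y in Metric.ball 0 δ, ‖fieldKernel y‖ₑ := by
  calc _ ≤ ∫⁻ y in Metric.ball x δ, ‖fieldKernel (x - y)‖ₑ ∂(C • volume) :=
        lintegral_mono' (Measure.restrict_mono_measure hμ _) le_rfl
    _ = C * ∫⁻ y in Metric.ball x δ, ‖fieldKernel (x - y)‖ₑ := by
        rw [Measure.restrict_smul, lintegral_smul_measure]; rfl
    _ = C * ∫⁻ y in Metric.ball 0 δ, ‖fieldKernel y‖ₑ := by
        congr 1
        rw [← lintegral_indicator measurableSet_ball, ← lintegral_indicator measurableSet_ball,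
          ← lintegral_sub_left_eq_self _ x]
        refine lintegral_congr fun y => ?_
        simp only [Set.indicator, Metric.mem_ball, dist_zero_right]
        rw [dist_comm, dist_eq_norm, sub_sub_cancel]

lemma setLIntegral_fieldKernel_ball_ne_top (δ : ℝ) :
    ∫⁻ y in Metric.ball (0 : ℂ) δ, ‖fieldKernel y‖ₑ ≠ ∞ := by
  have := (integrableOn_norm_fieldKernel_ball δ).2
  simp only [HasFiniteIntegral, enorm_norm] at this
  exact this.ne

/-- A bound of `∫ |x - y|⁻¹ dμ(y)` for a measure of density at most `C`. -/
def fieldBound (μ : Measure ℂ) (C : NNReal) : ℝ≥0∞ :=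
  (C * ∫⁻ y in Metric.ball (0 : ℂ) 1, ‖fieldKernel y‖ₑ) + μ Set.univ

lemma fieldBound_ne_top [IsFiniteMeasure μ] : fieldBound μ C ≠ ∞ :=
  ENNReal.add_ne_top.2 ⟨ENNReal.mul_ne_top ENNReal.coe_ne_top
    (setLIntegral_fieldKernel_ball_ne_top 1), measure_ne_top _ _⟩

/-- Split at `|x - y| = 1`: inside, the density bound compares with Lebesgue measure; outside, the
kernel is at most `1`. The bound does not depend on `x`. -/
lemma lintegral_fieldKernel_le (hμ : μ ≤ C • volume) (x : ℂ) :
    ∫⁻ y, ‖fieldKernel (x - y)‖ₑ ∂μ ≤ fieldBound μ C := by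
  rw [← lintegral_add_compl _ (measurableSet_ball (x := x) (ε := 1))]
  refine add_le_add (setLIntegral_fieldKernel_ball_le hμ x 1) ?_
  calc _ ≤ ∫⁻ y in (Metric.ball x 1)ᶜ, 1 ∂μ := by
        refine setLIntegral_mono measurable_const fun y hy => ?_
        have h1 : 1 ≤ ‖x - y‖ := by
          rw [← dist_eq_norm, dist_comm]; simpa using hy
        rw [← ofReal_norm, norm_fieldKernel, ENNReal.ofReal_le_one]
        exact inv_le_one_of_one_le₀ h1
    _ ≤ μ Set.univ := by simpa using measure_mono (Set.subset_univ _)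

lemma integrable_fieldKernel_sub [IsFiniteMeasure μ] (hμ : μ ≤ C • volume) (x : ℂ) :
    Integrable (fun y => fieldKernel (x - y)) μ :=
  ⟨(measurable_fieldKernel.comp (by fun_prop)).aestronglyMeasurable,
    (lintegral_fieldKernel_le hμ x).trans_lt (lt_top_iff_ne_top.2 fieldBound_ne_top)⟩

lemma chargeField_dirac (p x : ℂ) : chargeField (Measure.dirac p) x = fieldKernel (x - p) :=
  integral_dirac _ _

lemma integrable_dirac_fieldKernel (p x : ℂ) :
    Integrable (fun y => fieldKernel (x - y)) (Measure.dirac p) :=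
  integrable_dirac (by simp)

lemma dirac_compl_closedBall {p : ℂ} {ρ : ℝ} (hp : ‖p‖ ≤ ρ) :
    Measure.dirac p (Metric.closedBall 0 ρ)ᶜ = 0 := by
  rw [Measure.dirac_apply' _ measurableSet_closedBall.compl]
  simpa using hp

lemma setLIntegral_fieldKernel_sub_ne_top (p : ℂ) (r : ℝ) :
    ∫⁻ x in Metric.closedBall 0 r, ‖fieldKernel (x - p)‖ₑ ≠ ∞ := by
  have := (integrableOn_norm_fieldKernel_sub p r).2
  simp only [HasFiniteIntegral, enorm_norm] at this
  exact this.ne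

variable [IsFiniteMeasure μ] {ρ : ℝ}

lemma integral_inner_chargeField_self (hμ : μ ≤ C • volume) (hρ : 1 ≤ ρ)
    (h : μ (Metric.closedBall 0 ρ)ᶜ = 0) :
    Integrable (fun x => inner ℝ (chargeField μ x) (chargeField μ x)
      - μ.real Set.univ * μ.real Set.univ * tailKernel x) ∧
    ∫ x, (inner ℝ (chargeField μ x) (chargeField μ x)
      - μ.real Set.univ * μ.real Set.univ * tailKernel x)
      = -(2 * Real.pi * ∫ q : ℂ × ℂ, Real.log ‖q.1 - q.2‖ ∂(μ.prod μ)) := by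
  have := noAtoms_of_le_smul_volume hμ
  refine integral_inner_chargeField hρ h h (integrable_fieldKernel_sub hμ)
    (integrable_fieldKernel_sub hμ) ae_prod_ne (ne_top_of_le_ne_top ?_ <|
      setLIntegral_mono measurable_const fun x _ => mul_le_mul' (lintegral_fieldKernel_le hμ x)
        (lintegral_fieldKernel_le hμ x))
  rw [setLIntegral_const]
  exact ENNReal.mul_ne_top (ENNReal.mul_ne_top fieldBound_ne_top fieldBound_ne_top)
    (isCompact_closedBall _ _).measure_ne_top

/-- The case of a Dirac mass against `μ`: the field of `μ` is bounded, so only the locally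
integrable singularity at `p` remains, and the diagonal is null because `μ` has no atoms. -/
lemma integral_inner_fieldKernel_chargeField (hμ : μ ≤ C • volume) (hρ : 1 ≤ ρ)
    (h : μ (Metric.closedBall 0 ρ)ᶜ = 0) {p : ℂ} (hp : ‖p‖ ≤ ρ) :
    Integrable (fun x => inner ℝ (fieldKernel (x - p)) (chargeField μ x)
      - μ.real Set.univ * tailKernel x) ∧
    ∫ x, (inner ℝ (fieldKernel (x - p)) (chargeField μ x) - μ.real Set.univ * tailKernel x)
      = -(2 * Real.pi * ∫ y, Real.log ‖p - y‖ ∂μ) := by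
  have := noAtoms_of_le_smul_volume hμ
  have key := integral_inner_chargeField hρ (dirac_compl_closedBall hp) h
    (integrable_dirac_fieldKernel p) (integrable_fieldKernel_sub hμ) ae_prod_ne
    (ne_top_of_le_ne_top (b := ∫⁻ x in Metric.closedBall 0 (2 * ρ),
      ‖fieldKernel (x - p)‖ₑ * fieldBound μ C) ?_ ?_)
  · simp only [chargeField_dirac, probReal_univ, one_mul] at key
    refine ⟨key.1, key.2.trans ?_⟩
    rw [Measure.dirac_prod, integral_map (by fun_prop)]
    exact (by fun_prop : Measurable fun q : ℂ × ℂ => Real.log ‖q.1 - q.2‖).aestronglyMeasurable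
  · rw [lintegral_mul_const' _ _ fieldBound_ne_top]
    exact ENNReal.mul_ne_top (setLIntegral_fieldKernel_sub_ne_top p _) fieldBound_ne_top
  · refine lintegral_mono fun x => ?_
    dsimp only
    rw [lintegral_dirac]
    exact mul_le_mul_right (lintegral_fieldKernel_le hμ x) _

end BoundedDensity

end CoulombGas

end

/-! ### Differentiability of the logarithmic potential -/

noncomputable section

namespace CoulombGas

lemma fieldKernel_eq_smul (z : ℂ) : fieldKernel z = (‖z‖ ^ 2)⁻¹ • z := by
  rw [fieldKernel, Complex.inv_def, Complex.conj_conj, Complex.normSq_conj,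
    Complex.normSq_eq_norm_sq, Complex.real_smul, mul_comm]

lemma abs_log_norm_le (z : ℂ) : |Real.log ‖z‖| ≤ ‖fieldKernel z‖ + ‖z‖ := by
  rw [norm_fieldKernel]
  rcases eq_or_ne z 0 with rfl | hz
  · simp
  have h : 0 < ‖z‖ := norm_pos_iff.2 hz
  have h1 := Real.log_le_self h.le
  have h2 := Real.log_le_self (inv_pos.2 h).le
  rw [Real.log_inv] at h2
  have := inv_pos.2 h
  rw [abs_le]; constructor <;> linarith

lemma hasGradientAt_log_norm_sub {x y : ℂ} (h : x ≠ y) :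
    HasGradientAt (fun x : ℂ => Real.log ‖x - y‖) (fieldKernel (x - y)) x := by
  have hz : ‖x - y‖ ^ 2 ≠ 0 := pow_ne_zero _ (norm_ne_zero_iff.2 (sub_ne_zero.2 h))
  have h1 := (((hasFDerivAt_id (𝕜 := ℝ) x).sub_const y).norm_sq.log hz).const_mul (2⁻¹ : ℝ)
  rw [hasGradientAt_iff_hasFDerivAt]
  refine (h1.congr_fderiv ?_).congr_of_eventuallyEq (Eventually.of_forall fun w => ?_)
  · ext v
    rw [InnerProductSpace.toDual_apply_apply, fieldKernel_eq_smul, real_inner_smul_left]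
    change 2⁻¹ * ((‖x - y‖ ^ 2)⁻¹ * (2 • inner ℝ (x - y) v)) = _
    rw [nsmul_eq_mul]
    push_cast
    ring
  · simp [Real.log_pow]

/-- A smooth regularization of `fieldKernel`, the gradient of `log (|z|² + s⁴) / 2`. -/
def regKernel (s : ℝ) (z : ℂ) : ℂ := (‖z‖ ^ 2 + s ^ 4)⁻¹ • z

lemma hasGradientAt_log_reg {s : ℝ} (hs : 0 < s) (x y : ℂ) :
    HasGradientAt (fun x : ℂ => 2⁻¹ * Real.log (‖x - y‖ ^ 2 + s ^ 4)) (regKernel s (x - y)) x := by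
  have hz : ‖x - y‖ ^ 2 + s ^ 4 ≠ 0 := by positivity
  have h1 := ((((hasFDerivAt_id (𝕜 := ℝ) x).sub_const y).norm_sq.add_const (s ^ 4)).log
    hz).const_mul (2⁻¹ : ℝ)
  rw [hasGradientAt_iff_hasFDerivAt]
  refine h1.congr_fderiv ?_
  ext v
  rw [InnerProductSpace.toDual_apply_apply, regKernel, real_inner_smul_left]
  change 2⁻¹ * ((‖x - y‖ ^ 2 + s ^ 4)⁻¹ * (2 • inner ℝ (x - y) v)) = _
  rw [nsmul_eq_mul]
  push_cast
  ring

lemma continuous_regKernel {s : ℝ} (hs : 0 < s) : Continuous (regKernel s) := by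
  unfold regKernel
  exact Continuous.smul (Continuous.inv₀ (f := fun z : ℂ => ‖z‖ ^ 2 + s ^ 4) (by fun_prop)
    fun z => by positivity) continuous_id

lemma norm_regKernel_le {s : ℝ} (hs : 0 < s) (z : ℂ) : ‖regKernel s z‖ ≤ (s ^ 2)⁻¹ := by
  rw [regKernel, norm_smul, Real.norm_of_nonneg (by positivity), inv_mul_eq_div,
    div_le_iff₀ (by positivity), inv_mul_eq_div, le_div_iff₀ (by positivity)]
  nlinarith [sq_nonneg (‖z‖ - s ^ 2), norm_nonneg z, sq_nonneg s, mul_nonneg (norm_nonneg z) (sq_nonneg s)]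

/-- The difference has norm `s⁴ / (|z| (|z|² + s⁴))`. The fourth power is what makes this at most
`s` already from `|z| = s` on. -/
lemma norm_fieldKernel_sub_regKernel {s : ℝ} (hs : 0 < s) (z : ℂ) :
    ‖fieldKernel z - regKernel s z‖ ≤ ‖fieldKernel z‖ ∧
      (s ≤ ‖z‖ → ‖fieldKernel z - regKernel s z‖ ≤ s) := by
  rcases eq_or_ne z 0 with rfl | hz
  · simp [regKernel, fieldKernel, hs.le]
  have h : 0 < ‖z‖ := norm_pos_iff.2 hz
  have e : ‖fieldKernel z - regKernel s z‖ = s ^ 4 / (‖z‖ * (‖z‖ ^ 2 + s ^ 4)) := by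
    rw [fieldKernel_eq_smul, regKernel, ← sub_smul, norm_smul, Real.norm_of_nonneg]
    · field_simp; ring
    · rw [sub_nonneg]; gcongr; linarith [pow_pos hs 4]
  rw [e, norm_fieldKernel]
  constructor
  · rw [div_le_iff₀ (by positivity)]
    field_simp
    nlinarith
  · intro hsz
    calc s ^ 4 / (‖z‖ * (‖z‖ ^ 2 + s ^ 4)) ≤ s ^ 4 / (s * (s ^ 2 + 0)) := by
          gcongr; positivity
      _ = s := by field_simp; ring

lemma setLIntegral_fieldKernel_ball {δ : ℝ} (hδ : 0 ≤ δ) :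
    ∫⁻ y in Metric.ball (0 : ℂ) δ, ‖fieldKernel y‖ₑ = ENNReal.ofReal (2 * Real.pi * δ) := by
  have h := ofReal_integral_eq_lintegral_ofReal (integrableOn_norm_fieldKernel_ball δ)
    (ae_of_all _ fun _ => norm_nonneg _)
  simp only [ofReal_norm] at h
  rw [← h]
  congr 1
  have e : ∀ y : ℂ, (Metric.ball (0 : ℂ) δ).indicator (fun y => ‖fieldKernel y‖) y
      = (fun t : ℝ => (Set.Iio δ).indicator (fun t => t⁻¹) t) ‖y‖ := fun y => by
    simp [Set.indicator]
  rw [← integral_indicator measurableSet_ball]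
  simp only [e]
  rw [integral_fun_norm_addHaar, Complex.finrank_real_complex]
  have e2 : Set.EqOn (fun y : ℝ => y ^ (2 - 1) • (Set.Iio δ).indicator (fun t => t⁻¹) y)
      ((Set.Iio δ).indicator 1) (Set.Ioi 0) := fun y hy => by
    have : y ≠ 0 := ne_of_gt hy
    simp [Set.indicator, this]
  rw [setIntegral_congr_fun measurableSet_Ioi e2, setIntegral_indicator measurableSet_Iio,
    Set.Ioi_inter_Iio]
  simp [Measure.real, Complex.volume_ball, hδ]
  ring

section BoundedDensity

variable {μ : Measure ℂ} [IsFiniteMeasure μ] {C : NNReal} {ρ : ℝ}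

lemma integrable_of_continuous_of_compl_closedBall (h : μ (Metric.closedBall 0 ρ)ᶜ = 0)
    {E : Type*} [NormedAddCommGroup E] {f : ℂ → E} (hf : Continuous f) : Integrable f μ := by
  have h1 : IntegrableOn f (Metric.closedBall 0 ρ) μ :=
    hf.continuousOn.integrableOn_compact (isCompact_closedBall _ _)
  rwa [IntegrableOn, Measure.restrict_eq_self_of_ae_mem] at h1
  exact (ae_iff).2 h

lemma integrable_log_norm_sub (hμ : μ ≤ C • volume) (h : μ (Metric.closedBall 0 ρ)ᶜ = 0) (x : ℂ) :
    Integrable (fun y => Real.log ‖x - y‖) μ := by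
  refine ((integrable_fieldKernel_sub hμ x).norm.add
    (integrable_of_continuous_of_compl_closedBall h (f := fun y => ‖x - y‖)
      (by fun_prop))).mono' ?_ (ae_of_all _ fun y => abs_log_norm_le _)
  exact (by fun_prop : Measurable fun y : ℂ => Real.log ‖x - y‖).aestronglyMeasurable

lemma integrable_regKernel_sub {s : ℝ} (hs : 0 < s) (h : μ (Metric.closedBall 0 ρ)ᶜ = 0) (x : ℂ) :
    Integrable (fun y => regKernel s (x - y)) μ :=
  integrable_of_continuous_of_compl_closedBall h
    ((continuous_regKernel hs).comp (by fun_prop))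

/-- Split at distance `s` from `x`: the ball contributes at most the density bound times `∫ |z|⁻¹ =
2πs`, and outside it the kernels differ by at most `s`. Uniformity in `x` is the point. -/
lemma norm_chargeField_sub_integral_regKernel_le (hμ : μ ≤ C • volume)
    (h : μ (Metric.closedBall 0 ρ)ᶜ = 0) {s : ℝ} (hs : 0 < s) (x : ℂ) :
    ‖chargeField μ x - ∫ y, regKernel s (x - y) ∂μ‖
      ≤ (C * (2 * Real.pi) + μ.real Set.univ) * s := by
  have hB := measurableSet_ball (x := x) (ε := s)
  rw [chargeField, ← integral_sub (integrable_fieldKernel_sub hμ x)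
    (integrable_regKernel_sub hs h x)]
  refine (norm_integral_le_lintegral_norm _).trans ?_
  refine ENNReal.toReal_le_of_le_ofReal (by positivity) ?_
  simp only [ofReal_norm]
  rw [← lintegral_add_compl _ hB, add_mul, ENNReal.ofReal_add (by positivity) (by positivity)]
  refine add_le_add ?_ ?_
  · calc _ ≤ ∫⁻ y in Metric.ball x s, ‖fieldKernel (x - y)‖ₑ ∂μ := by
          refine lintegral_mono fun y => ?_
          simpa only [ofReal_norm] using
            ENNReal.ofReal_le_ofReal (norm_fieldKernel_sub_regKernel hs (x - y)).1
      _ ≤ C * ∫⁻ y in Metric.ball 0 s, ‖fieldKernel y‖ₑ := setLIntegral_fieldKernel_ball_le hμ x s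
      _ = _ := by
          rw [setLIntegral_fieldKernel_ball hs.le, mul_assoc (C : ℝ), ENNReal.ofReal_mul C.coe_nonneg,
            ENNReal.ofReal_coe_nnreal]
  · calc _ ≤ ∫⁻ y in (Metric.ball x s)ᶜ, ENNReal.ofReal s ∂μ := by
          refine setLIntegral_mono measurable_const fun y hy => ?_
          have h1 : s ≤ ‖x - y‖ := by
            rw [← dist_eq_norm, dist_comm]; simpa using hy
          simpa only [ofReal_norm] using
            ENNReal.ofReal_le_ofReal ((norm_fieldKernel_sub_regKernel hs (x - y)).2 h1)
      _ ≤ ENNReal.ofReal s * μ Set.univ := by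
          rw [setLIntegral_const]; gcongr; exact Set.subset_univ _
      _ = _ := by
          rw [ENNReal.ofReal_mul measureReal_nonneg, ofReal_measureReal, mul_comm]

lemma hasGradientAt_integral_log_reg (h : μ (Metric.closedBall 0 ρ)ᶜ = 0) {s : ℝ} (hs : 0 < s)
    (x : ℂ) :
    HasGradientAt (fun x => ∫ y, 2⁻¹ * Real.log (‖x - y‖ ^ 2 + s ^ 4) ∂μ)
      (∫ y, regKernel s (x - y) ∂μ) x := by
  have hc : ∀ x, Continuous fun y : ℂ => 2⁻¹ * Real.log (‖x - y‖ ^ 2 + s ^ 4) := fun x =>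
    continuous_const.mul (Continuous.log (by fun_prop) fun y => by positivity)
  have hk : Continuous fun y => InnerProductSpace.toDual ℝ ℂ (regKernel s (x - y)) :=
    (InnerProductSpace.toDual ℝ ℂ).continuous.comp ((continuous_regKernel hs).comp (by fun_prop))
  have key := hasFDerivAt_integral_of_dominated_of_fderiv_le (μ := μ) (𝕜 := ℝ) (s := Set.univ)
    (x₀ := x) (bound := fun _ => (s ^ 2)⁻¹)
    (F := fun x y => 2⁻¹ * Real.log (‖x - y‖ ^ 2 + s ^ 4))
    (F' := fun x y => InnerProductSpace.toDual ℝ ℂ (regKernel s (x - y))) univ_mem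
    (Eventually.of_forall fun x => (hc x).aestronglyMeasurable)
    (integrable_of_continuous_of_compl_closedBall h (hc x))
    hk.aestronglyMeasurable
    (ae_of_all _ fun y x _ => by
      rw [LinearIsometryEquiv.norm_map]; exact norm_regKernel_le hs _)
    (integrable_const _)
    (ae_of_all _ fun y x _ => (hasGradientAt_log_reg hs x y).hasFDerivAt)
  rw [hasGradientAt_iff_hasFDerivAt]
  refine key.congr_fderiv ?_
  ext v
  rw [ContinuousLinearMap.integral_apply (integrable_of_continuous_of_compl_closedBall h hk)]
  simp only [InnerProductSpace.toDual_apply_apply]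
  simp only [real_inner_comm v]
  rw [integral_inner (integrable_regKernel_sub hs h x)]

/-- The singularity of the kernel moves with `x`, which rules out direct differentiation under the
integral. The regularized potentials converge pointwise and their gradients uniformly, so the limit
may be differentiated. -/
lemma hasGradientAt_integral_log (hμ : μ ≤ C • volume) (h : μ (Metric.closedBall 0 ρ)ᶜ = 0)
    (x : ℂ) : HasGradientAt (fun x => ∫ y, Real.log ‖x - y‖ ∂μ) (chargeField μ x) x := by
  have := noAtoms_of_le_smul_volume hμ
  set s : ℕ → ℝ := fun n => 1 / ((n : ℝ) + 1) with hs_def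
  have hs : ∀ n, 0 < s n := fun n => by positivity
  have hs1 : ∀ n, s n ≤ 1 := fun n => by
    rw [hs_def, div_le_one (by positivity)]; linarith [n.cast_nonneg (α := ℝ)]
  have hs0 : Tendsto s atTop (𝓝 0) := tendsto_one_div_add_atTop_nhds_zero_nat
  rw [hasGradientAt_iff_hasFDerivAt]
  refine hasFDerivAt_of_tendstoUniformly (l := atTop)
    (f := fun n x => ∫ y, 2⁻¹ * Real.log (‖x - y‖ ^ 2 + s n ^ 4) ∂μ)
    (f' := fun n x => InnerProductSpace.toDual ℝ ℂ (∫ y, regKernel (s n) (x - y) ∂μ))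
    (g' := fun x => InnerProductSpace.toDual ℝ ℂ (chargeField μ x)) ?_
    (fun n x => (hasGradientAt_integral_log_reg h (hs n) x).hasFDerivAt) ?_ x
  · rw [Metric.tendstoUniformly_iff]
    intro e he
    have h0 : Tendsto (fun n => (C * (2 * Real.pi) + μ.real Set.univ) * s n) atTop (𝓝 0) := by
      simpa using hs0.const_mul (C * (2 * Real.pi) + μ.real Set.univ)
    filter_upwards [h0.eventually_lt_const he] with n hn x
    rw [dist_eq_norm, ← map_sub, LinearIsometryEquiv.norm_map]
    exact (norm_chargeField_sub_integral_regKernel_le hμ h (hs n) x).trans_lt hn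
  · intro x
    have hc : ∀ {t : ℝ}, 0 < t → Continuous fun y : ℂ => 2⁻¹ * Real.log (‖x - y‖ ^ 2 + t ^ 4) :=
      fun ht => continuous_const.mul (Continuous.log (by fun_prop) fun y => by positivity)
    -- The regularized logarithm increases with `s`, so for `s ≤ 1` it lies between `log|x - y|` and
    -- its value at `s = 1`; their absolute values dominate.
    refine tendsto_integral_of_dominated_convergence
      (fun y => |Real.log ‖x - y‖| + |2⁻¹ * Real.log (‖x - y‖ ^ 2 + 1 ^ 4)|)
      (fun n => (hc (hs n)).aestronglyMeasurable)
      ((integrable_log_norm_sub hμ h x).abs.add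
        (integrable_of_continuous_of_compl_closedBall h (hc one_pos)).abs) ?_ ?_
    · intro n
      have hx : ∀ᵐ y ∂μ, y ≠ x := by simp [ae_iff]
      filter_upwards [hx] with y hy
      have hz : 0 < ‖x - y‖ := norm_pos_iff.2 (sub_ne_zero.2 hy.symm)
      have e1 : Real.log ‖x - y‖ = 2⁻¹ * Real.log (‖x - y‖ ^ 2) := by
        rw [Real.log_pow]; push_cast; ring
      have l1 : Real.log ‖x - y‖ ≤ 2⁻¹ * Real.log (‖x - y‖ ^ 2 + s n ^ 4) := by
        rw [e1]; gcongr; linarith [pow_pos (hs n) 4]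
      have l2 : 2⁻¹ * Real.log (‖x - y‖ ^ 2 + s n ^ 4)
          ≤ 2⁻¹ * Real.log (‖x - y‖ ^ 2 + 1 ^ 4) := by
        have := hs n; have := hs1 n; gcongr
      rw [Real.norm_eq_abs, abs_le]
      constructor
      · linarith [neg_abs_le (Real.log ‖x - y‖),
          abs_nonneg (2⁻¹ * Real.log (‖x - y‖ ^ 2 + 1 ^ 4))]
      · linarith [le_abs_self (2⁻¹ * Real.log (‖x - y‖ ^ 2 + 1 ^ 4)),
          abs_nonneg (Real.log ‖x - y‖)]
    · have hx : ∀ᵐ y ∂μ, y ≠ x := by simp [ae_iff]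
      filter_upwards [hx] with y hy
      have hz : 0 < ‖x - y‖ := norm_pos_iff.2 (sub_ne_zero.2 hy.symm)
      have e1 : Real.log ‖x - y‖ = 2⁻¹ * Real.log (‖x - y‖ ^ 2 + 0 ^ 4) := by
        rw [zero_pow four_ne_zero, add_zero, Real.log_pow]; push_cast; ring
      rw [e1]
      exact (((hs0.pow 4).const_add _).log (by positivity)).const_mul _

end BoundedDensity

end CoulombGas

end

/-! ### Renormalized energy of point charges in a neutralizing background -/

noncomputable section

namespace CoulombGas

/-- The squared kernel on the annulus `a ≤ |z| < b`. -/
def annulusKernel (a b : ℝ) (z : ℂ) : ℝ := if a ≤ ‖z‖ ∧ ‖z‖ < b then (‖z‖ ^ 2)⁻¹ else 0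

lemma integral_annulusKernel {a b : ℝ} (ha : 0 < a) (hab : a ≤ b) :
    Integrable (annulusKernel a b) ∧
      ∫ z, annulusKernel a b z = 2 * Real.pi * (Real.log b - Real.log a) := by
  have e : annulusKernel a b
      = fun z : ℂ => (fun t : ℝ => (Set.Ico a b).indicator (fun t => (t ^ 2)⁻¹) t) ‖z‖ := by
    ext z; simp [annulusKernel, Set.indicator]
  have e2 : Set.EqOn (fun y : ℝ => y ^ (2 - 1) • (Set.Ico a b).indicator (fun t => (t ^ 2)⁻¹) y)
      ((Set.Ico a b).indicator fun t => t⁻¹) (Set.Ioi 0) := fun y hy => by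
    have : y ≠ 0 := ne_of_gt hy
    simp only [Set.indicator, smul_eq_mul]
    split_ifs
    · rw [show 2 - 1 = 1 from rfl]; field_simp
    · simp
  have hsub : Set.Ico a b ⊆ Set.Ioi 0 := fun t ht => ha.trans_le ht.1
  constructor
  · rw [e, integrable_fun_norm_addHaar, Complex.finrank_real_complex,
      integrableOn_congr_fun e2 measurableSet_Ioi]
    refine Integrable.restrict ?_
    rw [integrable_indicator_iff measurableSet_Ico]
    refine IntegrableOn.mono_set (ContinuousOn.integrableOn_Icc (a := a) (b := b)
      (continuousOn_inv₀.mono fun x hx => ?_)) Set.Ico_subset_Icc_self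
    exact (ha.trans_le hx.1).ne'
  · rw [e]
    rw [integral_fun_norm_addHaar, Complex.finrank_real_complex,
      setIntegral_congr_fun measurableSet_Ioi e2, setIntegral_indicator measurableSet_Ico,
      Set.inter_eq_right.2 hsub, integral_Ico_eq_integral_Ioo, ← integral_Ioc_eq_integral_Ioo,
      ← intervalIntegral.integral_of_le hab, integral_inv_of_pos ha (ha.trans_le hab),
      Real.log_div (ha.trans_le hab).ne' ha.ne']
    simp [Measure.real, Complex.volume_ball]
    ring

/-- The squared kernel on the ball `|z| < δ`. -/
def coreKernel (δ : ℝ) (z : ℂ) : ℝ := if ‖z‖ < δ then (‖z‖ ^ 2)⁻¹ else 0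

/-- With its core removed, the self-interaction is an annulus `δ ≤ |x - p| < 1` plus a translated
tail of integral zero. The radius `δ` thus plays the role of `|a - b|`. -/
lemma integral_selfKernel {δ : ℝ} (hδ : 0 < δ) (hδ1 : δ ≤ 1) (p : ℂ) :
    Integrable (fun x => inner ℝ (fieldKernel (x - p)) (fieldKernel (x - p))
      - coreKernel δ (x - p) - tailKernel x) ∧
    ∫ x, (inner ℝ (fieldKernel (x - p)) (fieldKernel (x - p))
      - coreKernel δ (x - p) - tailKernel x) = -(2 * Real.pi * Real.log δ) := by
  have e : ∀ x, inner ℝ (fieldKernel (x - p)) (fieldKernel (x - p))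
      - coreKernel δ (x - p) - tailKernel x
      = annulusKernel δ 1 (x - p) + (tailKernel (x - p) - tailKernel x) := by
    intro x
    rw [inner_fieldKernel_self, coreKernel, annulusKernel, show tailKernel (x - p) = ite _ _ _ from rfl]
    by_cases h1 : ‖x - p‖ < δ
    · have h2 : ¬ (1 ≤ ‖x - p‖) := by linarith
      simp [h1, h2, not_le.2 h1]
    · by_cases h2 : 1 ≤ ‖x - p‖
      · simp [h1, h2, not_lt.2 h2]
      · simp [h1, h2, not_lt.1 h1, not_le.1 h2]
        ring
  obtain ⟨hi, hv⟩ := integral_annulusKernel hδ hδ1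
  simp only [e]
  refine ⟨(hi.comp_sub_right p).add (integrable_tailKernel_sub p), ?_⟩
  rw [integral_add (hi.comp_sub_right p) (integrable_tailKernel_sub p), integral_tailKernel_sub,
    integral_sub_right_eq_self (annulusKernel δ 1), hv]
  simp

section Configuration

variable {n : ℕ} (p : Fin n → ℂ) (μ : Measure ℂ) (δ : ℝ)

/-- The field of the charges `p` in the background `μ`. -/
def totalField (x : ℂ) : ℂ := chargeField μ x - ∑ i, fieldKernel (x - p i)

/-- The integrable part of the squared norm of `totalField`. -/
def regularPart (x : ℂ) : ℝ :=
  ((∑ i, ∑ j, (inner ℝ (fieldKernel (x - p i)) (fieldKernel (x - p j))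
      - (if p i = p j then coreKernel δ (x - p i) else 0) - tailKernel x))
    - 2 * ∑ i, (inner ℝ (fieldKernel (x - p i)) (chargeField μ x) - n * tailKernel x))
    + (inner ℝ (chargeField μ x) (chargeField μ x) - n * n * tailKernel x)

/-- The tails subtracted in `regularPart` cancel: `n² - 2n·n + n² = 0`. -/
lemma norm_totalField_sq (x : ℂ) :
    ‖totalField p μ x‖ ^ 2
      = (∑ i, ∑ j, if p i = p j then coreKernel δ (x - p i) else 0) + regularPart p μ δ x := by
  rw [totalField, ← real_inner_self_eq_norm_sq, inner_sub_left, inner_sub_right, inner_sub_right,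
    real_inner_comm (∑ i, fieldKernel (x - p i)) (chargeField μ x), sum_inner, sum_inner]
  simp only [inner_sum, regularPart, Finset.sum_sub_distrib, Finset.sum_const, Finset.card_univ,
    Fintype.card_fin, nsmul_eq_mul]
  ring

/-- `log |p i - p j|`, with the value `log δ` if the points coincide. -/
def logDist (i j : Fin n) : ℝ := if p i = p j then Real.log δ else Real.log ‖p i - p j‖

/-- Because `μ` has mass `n`, each bracket of `regularPart` carries exactly the tail that makes it
integrable, so the pieces can be integrated one by one. -/
lemma integral_regularPart [IsFiniteMeasure μ] {C : NNReal} {ρ : ℝ} (hμ : μ ≤ C • volume)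
    (h : μ (Metric.closedBall 0 ρ)ᶜ = 0) (hmass : μ.real Set.univ = n) (hδ : 0 < δ)
    (hδ1 : δ ≤ 1) :
    Integrable (regularPart p μ δ) ∧ ∫ x, regularPart p μ δ x
      = -(2 * Real.pi * (((∑ i, ∑ j, logDist p δ i j) - 2 * ∑ i, ∫ y, Real.log ‖p i - y‖ ∂μ)
        + ∫ q : ℂ × ℂ, Real.log ‖q.1 - q.2‖ ∂(μ.prod μ))) := by
  obtain ⟨R, hR1, hρR, hp⟩ : ∃ R : ℝ, 1 ≤ R ∧ ρ ≤ R ∧ ∀ i, ‖p i‖ ≤ R := by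
    refine ⟨max 1 (max ρ (∑ i, ‖p i‖)), le_max_left _ _,
      (le_max_left _ _).trans (le_max_right _ _), fun i => ?_⟩
    exact (Finset.single_le_sum (f := fun i => ‖p i‖) (fun _ _ => norm_nonneg _)
      (Finset.mem_univ i)).trans ((le_max_right _ _).trans (le_max_right _ _))
  have hR : μ (Metric.closedBall 0 R)ᶜ = 0 :=
    measure_mono_null (Set.compl_subset_compl.2 (Metric.closedBall_subset_closedBall hρR)) h
  have hij : ∀ i j, Integrable (fun x => inner ℝ (fieldKernel (x - p i)) (fieldKernel (x - p j))
      - (if p i = p j then coreKernel δ (x - p i) else 0) - tailKernel x) ∧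
      ∫ x, (inner ℝ (fieldKernel (x - p i)) (fieldKernel (x - p j))
      - (if p i = p j then coreKernel δ (x - p i) else 0) - tailKernel x)
      = -(2 * Real.pi * logDist p δ i j) := by
    intro i j
    by_cases hpij : p i = p j
    · simp only [logDist, hpij, if_true]
      exact integral_selfKernel hδ hδ1 (p j)
    · simp only [logDist, hpij, if_false, sub_zero]
      exact ⟨integrable_pairKernel hpij, integral_pairKernel hpij⟩
  have hi := fun i => integral_inner_fieldKernel_chargeField hμ hR1 hR (hp i)
  have h0 := integral_inner_chargeField_self hμ hR1 hR
  simp only [hmass] at hi h0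
  have i1 := integrable_finsetSum Finset.univ fun i _ =>
    integrable_finsetSum Finset.univ fun j _ => (hij i j).1
  have i2 := (integrable_finsetSum Finset.univ fun i _ => (hi i).1).const_mul (2 : ℝ)
  have i12 : Integrable fun x =>
      (∑ i, ∑ j, (inner ℝ (fieldKernel (x - p i)) (fieldKernel (x - p j))
        - (if p i = p j then coreKernel δ (x - p i) else 0) - tailKernel x))
      - 2 * ∑ i, (inner ℝ (fieldKernel (x - p i)) (chargeField μ x) - n * tailKernel x) :=
    i1.sub i2
  refine ⟨i12.add h0.1, ?_⟩
  simp only [regularPart]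
  rw [integral_add i12 h0.1, integral_sub i1 i2, integral_const_mul,
    integral_finsetSum _ fun i _ => (hi i).1,
    integral_finsetSum _ fun i _ => integrable_finsetSum Finset.univ fun j _ => (hij i j).1, h0.2]
  simp only [integral_finsetSum _ fun j _ => (hij _ j).1, (hij _ _).2, (hi _).2]
  simp only [Finset.sum_neg_distrib, ← Finset.mul_sum]
  ring

/-- The number of pairs of coinciding points. -/
def coincidences : ℝ := ∑ i, ∑ j, if p i = p j then 1 else 0

/-- Cores of radius `δ` about distinct points are then disjoint, and a hole of radius `η ≤ δ` does
not cut into the core of another point. -/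
lemma exists_separation : ∃ δ : ℝ, 0 < δ ∧ δ ≤ 1 ∧ ∀ i j, p i ≠ p j → 2 * δ ≤ ‖p i - p j‖ := by
  have h1 : ∀ᶠ δ : ℝ in 𝓝[>] 0, ∀ i j, p i ≠ p j → 2 * δ ≤ ‖p i - p j‖ := by
    rw [eventually_all]
    intro i
    rw [eventually_all]
    intro j
    by_cases hij : p i = p j
    · simp [hij]
    · have : 0 < ‖p i - p j‖ / 2 := half_pos (norm_pos_iff.2 (sub_ne_zero.2 hij))
      filter_upwards [nhdsWithin_le_nhds (Iic_mem_nhds this)] with δ hδ _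
      have : δ ≤ ‖p i - p j‖ / 2 := hδ
      linarith
  have h2 : ∀ᶠ δ : ℝ in 𝓝[>] 0, δ ≤ 1 := nhdsWithin_le_nhds (Iic_mem_nhds one_pos)
  have h3 : ∀ᶠ δ : ℝ in 𝓝[>] 0, 0 < δ := self_mem_nhdsWithin
  obtain ⟨δ, h, hδ, hδ0⟩ := (h1.and (h2.and h3)).exists
  exact ⟨δ, hδ0, hδ, h⟩

/-- The plane without the balls of radius `η` about the charges. -/
def puncturedPlane (η : ℝ) : Set ℂ := (⋃ i, Metric.ball (p i) η)ᶜ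

lemma measurableSet_puncturedPlane (η : ℝ) : MeasurableSet (puncturedPlane p η) :=
  (MeasurableSet.iUnion fun _ => measurableSet_ball).compl

lemma mem_puncturedPlane {η : ℝ} {x : ℂ} : x ∈ puncturedPlane p η ↔ ∀ i, η ≤ ‖x - p i‖ := by
  simp [puncturedPlane, dist_eq_norm]

lemma integral_core_puncturedPlane {η : ℝ} (hη : 0 < η) (hηδ : η ≤ δ)
    (hsep : ∀ i j, p i ≠ p j → 2 * δ ≤ ‖p i - p j‖) :
    IntegrableOn (fun x => ∑ i, ∑ j, if p i = p j then coreKernel δ (x - p i) else 0)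
      (puncturedPlane p η) ∧
    ∫ x in puncturedPlane p η, (∑ i, ∑ j, if p i = p j then coreKernel δ (x - p i) else 0)
      = 2 * Real.pi * coincidences p * (Real.log δ - Real.log η) := by
  have hm := measurableSet_puncturedPlane p η
  obtain ⟨hi, hv⟩ := integral_annulusKernel hη hηδ
  have e : ∀ i, (puncturedPlane p η).indicator (fun x => coreKernel δ (x - p i))
      = fun x => annulusKernel η δ (x - p i) := by
    intro i
    ext x
    by_cases hx : ‖x - p i‖ < δ
    · by_cases hx2 : η ≤ ‖x - p i‖
      · rw [Set.indicator_of_mem, coreKernel, annulusKernel, if_pos hx, if_pos ⟨hx2, hx⟩]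
        rw [mem_puncturedPlane]
        intro j
        by_cases hij : p i = p j
        · rwa [← hij]
        -- A point within `δ` of `p i` is at distance at least `2δ - δ ≥ η` from `p j`.
        · have h1 := hsep i j hij
          have h2 : ‖p i - p j‖ ≤ ‖x - p j‖ + ‖x - p i‖ := by
            have := norm_sub_le (x - p j) (x - p i)
            simpa using this
          linarith
      · rw [Set.indicator_of_notMem, annulusKernel, if_neg fun h => hx2 h.1]
        rw [mem_puncturedPlane]
        exact fun h => hx2 (h i)
    · rw [annulusKernel, if_neg fun h => hx h.2, Set.indicator_apply_eq_zero]
      intro _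
      rw [coreKernel, if_neg hx]
  have hI : ∀ i, IntegrableOn (fun x => coreKernel δ (x - p i)) (puncturedPlane p η) := by
    intro i
    rw [← integrable_indicator_iff hm, e i]
    exact hi.comp_sub_right _
  have hV : ∀ i, ∫ x in puncturedPlane p η, coreKernel δ (x - p i)
      = 2 * Real.pi * (Real.log δ - Real.log η) := by
    intro i
    rw [← integral_indicator hm, e i, integral_sub_right_eq_self (annulusKernel η δ), hv]
  have hIf : ∀ i j, IntegrableOn (fun x => if p i = p j then coreKernel δ (x - p i) else 0)
      (puncturedPlane p η) := by
    intro i j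
    split_ifs
    · exact hI i
    · exact integrableOn_zero
  refine ⟨integrable_finsetSum _ fun i _ => integrable_finsetSum _ fun j _ => hIf i j, ?_⟩
  rw [integral_finsetSum _ fun i _ => integrable_finsetSum _ fun j _ => hIf i j]
  simp only [integral_finsetSum _ fun j _ => hIf _ j]
  rw [coincidences, Finset.mul_sum, Finset.sum_mul]
  refine Finset.sum_congr rfl fun i _ => ?_
  rw [Finset.mul_sum, Finset.sum_mul]
  refine Finset.sum_congr rfl fun j _ => ?_
  split_ifs
  · rw [hV]; ring
  · simp

lemma tendsto_setIntegral_puncturedPlane {f : ℂ → ℝ} (hf : Integrable f) :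
    Tendsto (fun η => ∫ x in puncturedPlane p η, f x) (𝓝[>] 0) (𝓝 (∫ x, f x)) := by
  simp only [← integral_indicator (measurableSet_puncturedPlane p _)]
  refine tendsto_integral_filter_of_dominated_convergence (fun x => ‖f x‖) ?_ ?_ hf.norm ?_
  · exact Eventually.of_forall fun η =>
      (hf.indicator (measurableSet_puncturedPlane p η)).aestronglyMeasurable
  · exact Eventually.of_forall fun η => ae_of_all _ fun x => norm_indicator_le_norm_self _ _
  · have hx : ∀ᵐ x : ℂ, ∀ i, x ≠ p i := by
      rw [ae_all_iff]; intro i; simp [ae_iff]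
    filter_upwards [hx] with x hx
    refine tendsto_const_nhds.congr' ?_
    have : ∀ᶠ η : ℝ in 𝓝[>] 0, ∀ i, η ≤ ‖x - p i‖ := by
      rw [eventually_all]
      exact fun i => nhdsWithin_le_nhds (Iic_mem_nhds (norm_pos_iff.2 (sub_ne_zero.2 (hx i))))
    filter_upwards [this] with η hη
    rw [Set.indicator_of_mem ((mem_puncturedPlane p).2 hη)]

/-- The truncated energy in terms of the regular part of the field. -/
lemma half_lintegral_totalField_sq {η : ℝ} (hη : 0 < η) (hηδ : η ≤ δ)
    (hsep : ∀ i j, p i ≠ p j → 2 * δ ≤ ‖p i - p j‖) (hreg : Integrable (regularPart p μ δ)) :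
    ((2⁻¹ * ∫⁻ x in puncturedPlane p η, ‖totalField p μ x‖ₑ ^ 2 : ℝ≥0∞) : EReal)
      = ((Real.pi * coincidences p * (Real.log δ - Real.log η)
        + 2⁻¹ * ∫ x in puncturedPlane p η, regularPart p μ δ x : ℝ) : EReal) := by
  obtain ⟨hi, hv⟩ := integral_core_puncturedPlane p δ hη hηδ hsep
  have hI : IntegrableOn (fun x => ‖totalField p μ x‖ ^ 2) (puncturedPlane p η) := by
    simp only [norm_totalField_sq p μ δ]
    exact hi.add hreg.integrableOn
  have h1 := ofReal_integral_eq_lintegral_ofReal hI (ae_of_all _ fun _ => by positivity)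
  simp only [ENNReal.ofReal_pow (norm_nonneg _), ofReal_norm] at h1
  have h2 : (2⁻¹ : ℝ≥0∞) = ENNReal.ofReal 2⁻¹ := by
    rw [ENNReal.ofReal_inv_of_pos two_pos, ENNReal.ofReal_ofNat]
  rw [← h1, h2, ← ENNReal.ofReal_mul (by norm_num), EReal.coe_ennreal_ofReal, max_eq_left]
  · simp only [norm_totalField_sq p μ δ]
    rw [integral_add hi hreg.integrableOn, hv]
    congr 1
    ring
  · exact mul_nonneg (by norm_num) (integral_nonneg fun _ => by positivity)

/-- The interaction energy of distinct charges in the background `μ`. -/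
def interactionEnergy : ℝ :=
  -(∑ i, ∑ j ∈ Finset.univ.erase i, Real.log ‖p i - p j‖)
    + 2 * (∑ i, ∫ y, Real.log ‖p i - y‖ ∂μ) - ∫ q : ℂ × ℂ, Real.log ‖q.1 - q.2‖ ∂(μ.prod μ)

lemma coincidences_of_injective (hp : Function.Injective p) : coincidences p = n := by
  simp [coincidences, hp.eq_iff]

/-- Every row counts its diagonal entry, and the row of a repeated point counts at least two. -/
lemma lt_coincidences (hp : ¬ Function.Injective p) : (n : ℝ) < coincidences p := by
  have hle : ∀ i, (1 : ℝ) ≤ ∑ j, if p i = p j then 1 else 0 := fun i => by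
    refine le_trans ?_ (Finset.single_le_sum (f := fun j => if p i = p j then (1 : ℝ) else 0)
      (fun j _ => by split_ifs <;> norm_num) (Finset.mem_univ i))
    simp
  have : ∑ _i : Fin n, (1 : ℝ) = n := by simp
  rw [← this]
  refine Finset.sum_lt_sum (fun i _ => hle i) ?_
  simp only [Function.Injective, not_forall] at hp
  obtain ⟨a, b, hab, hne⟩ := hp
  refine ⟨a, Finset.mem_univ a, ?_⟩
  have h2 : ∑ j ∈ {a, b}, (if p a = p j then (1 : ℝ) else 0)
      ≤ ∑ j, if p a = p j then (1 : ℝ) else 0 :=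
    Finset.sum_le_sum_of_subset_of_nonneg (Finset.subset_univ _)
      fun j _ _ => by split_ifs <;> norm_num
  rw [Finset.sum_pair hne, if_pos rfl, if_pos hab] at h2
  linarith

lemma sum_logDist_of_injective (hp : Function.Injective p) :
    ∑ i, ∑ j, logDist p δ i j
      = n * Real.log δ + ∑ i, ∑ j ∈ Finset.univ.erase i, Real.log ‖p i - p j‖ := by
  have : ∀ i, ∑ j, logDist p δ i j
      = Real.log δ + ∑ j ∈ Finset.univ.erase i, Real.log ‖p i - p j‖ := fun i => by
    rw [← Finset.add_sum_erase _ _ (Finset.mem_univ i), logDist, if_pos rfl]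
    congr 1
    refine Finset.sum_congr rfl fun j hj => ?_
    rw [logDist, if_neg]
    exact fun h => (Finset.ne_of_mem_erase hj) (hp h).symm
  simp [this, Finset.sum_add_distrib]

/-- The limit of the truncated energies of the field. -/
theorem tendsto_truncated_totalField [IsFiniteMeasure μ] {C : NNReal} {ρ : ℝ}
    (hμ : μ ≤ C • volume) (h : μ (Metric.closedBall 0 ρ)ᶜ = 0) (hmass : μ.real Set.univ = n) :
    Tendsto (fun η => ((2⁻¹ * ∫⁻ x in puncturedPlane p η, ‖totalField p μ x‖ₑ ^ 2 : ℝ≥0∞) : EReal)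
        + ((Real.pi * n * Real.log η : ℝ) : EReal)) (𝓝[>] 0)
      (𝓝 (open Classical in if Function.Injective p
        then ((Real.pi * interactionEnergy p μ : ℝ) : EReal) else ⊤)) := by
  obtain ⟨δ, hδ, hδ1, hsep⟩ := exists_separation p
  obtain ⟨hreg, hval⟩ := integral_regularPart p μ δ hμ h hmass hδ hδ1
  have hlim := tendsto_setIntegral_puncturedPlane p hreg
  -- The cores give `π · coincidences · (log δ - log η)`; together with `π n log η` the coefficient
  -- of `-log η` is `π (coincidences - n)`.
  have hev : ∀ᶠ η in 𝓝[>] (0 : ℝ),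
      ((Real.pi * coincidences p * Real.log δ + 2⁻¹ * (∫ x in puncturedPlane p η,
        regularPart p μ δ x) + Real.pi * (coincidences p - n) * -Real.log η : ℝ) : EReal)
      = ((2⁻¹ * ∫⁻ x in puncturedPlane p η, ‖totalField p μ x‖ₑ ^ 2 : ℝ≥0∞) : EReal)
        + ((Real.pi * n * Real.log η : ℝ) : EReal) := by
    filter_upwards [nhdsWithin_le_nhds (Iic_mem_nhds hδ), self_mem_nhdsWithin] with η h1 h2
    rw [half_lintegral_totalField_sq p μ δ h2 h1 hsep hreg, ← EReal.coe_add]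
    congr 1
    ring
  refine Tendsto.congr' hev ?_
  split_ifs with hp
  -- For distinct points the `log η` terms cancel, and `n log δ` cancels against the diagonal of
  -- `logDist`, so the auxiliary radius disappears.
  · rw [EReal.tendsto_coe, coincidences_of_injective p hp]
    simp only [sub_self, mul_zero, zero_mul, add_zero]
    have := (hlim.const_mul (2⁻¹ : ℝ)).const_add (Real.pi * n * Real.log δ)
    convert this using 2
    rw [hval, sum_logDist_of_injective p δ hp, interactionEnergy]
    ring
  · rw [EReal.tendsto_coe_nhds_top_iff]
    refine ((hlim.const_mul (2⁻¹ : ℝ)).const_add _).add_atTop ?_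
    refine Tendsto.const_mul_atTop ?_ (tendsto_neg_atBot_atTop.comp Real.tendsto_log_nhdsGT_zero)
    have := lt_coincidences p hp
    exact mul_pos Real.pi_pos (by linarith)

end Configuration

end CoulombGas

end

/-! ### Logarithmic energy, circle measures and the first variation -/

noncomputable section

namespace CoulombGas

lemma negLog_self (x : ℂ) : negLog x x = ⊤ := by simp [negLog]

lemma negLog_of_ne {x y : ℂ} (h : x ≠ y) : negLog x y = ((-Real.log ‖x - y‖ : ℝ) : EReal) := by
  rw [negLog, edist_dist, dist_eq_norm,
    ENNReal.log_ofReal_of_pos (norm_pos_iff.2 (sub_ne_zero.2 h)), EReal.coe_neg]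

lemma measurable_negLog : Measurable fun p : ℂ × ℂ => negLog p.1 p.2 := by
  unfold negLog
  exact continuous_neg.measurable.comp (ENNReal.continuous_log.measurable.comp measurable_edist)

lemma measurable_log_norm_sub : Measurable fun q : ℂ × ℂ => Real.log ‖q.1 - q.2‖ := by fun_prop

lemma logEnergy_eq {μ : Measure ℂ} (hne : ∀ᵐ q ∂(μ.prod μ), q.1 ≠ q.2)
    (hi : Integrable (fun q : ℂ × ℂ => Real.log ‖q.1 - q.2‖) (μ.prod μ)) :
    logEnergy μ = ((-∫ q : ℂ × ℂ, Real.log ‖q.1 - q.2‖ ∂(μ.prod μ) : ℝ) : EReal) := by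
  have h1 : ∫⁻ p : ℂ × ℂ, (negLog p.1 p.2).toENNReal ∂(μ.prod μ)
      = ∫⁻ p : ℂ × ℂ, ENNReal.ofReal (-Real.log ‖p.1 - p.2‖) ∂(μ.prod μ) := by
    refine lintegral_congr_ae ?_
    filter_upwards [hne] with q hq
    rw [negLog_of_ne hq, EReal.real_coe_toENNReal]
  have h2 : ∫⁻ p : ℂ × ℂ, (-negLog p.1 p.2).toENNReal ∂(μ.prod μ)
      = ∫⁻ p : ℂ × ℂ, ENNReal.ofReal (Real.log ‖p.1 - p.2‖) ∂(μ.prod μ) := by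
    refine lintegral_congr_ae ?_
    filter_upwards [hne] with q hq
    rw [negLog_of_ne hq, ← EReal.coe_neg, neg_neg, EReal.real_coe_toENNReal]
  have f1 := hi.lintegral_lt_top
  have f2 := hi.neg.lintegral_lt_top
  simp only [Pi.neg_apply] at f2
  rw [logEnergy, h1, h2, integral_eq_lintegral_pos_part_sub_lintegral_neg_part hi, neg_sub,
    EReal.coe_sub, EReal.coe_ennreal_toReal f1.ne, EReal.coe_ennreal_toReal f2.ne]

lemma log_norm_sub_le (x y : ℂ) :
    Real.log ‖x - y‖ ≤ Real.log (1 + ‖x‖) + Real.log (1 + ‖y‖) := by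
  have hx := norm_nonneg x
  have hy := norm_nonneg y
  rcases eq_or_ne x y with rfl | h
  -- On the diagonal the real logarithm takes its default value `0`.
  · rw [sub_self, norm_zero, Real.log_zero]
    have := Real.log_nonneg (by linarith : 1 ≤ 1 + ‖x‖)
    linarith
  rw [← Real.log_mul (by positivity) (by positivity)]
  refine Real.log_le_log (norm_pos_iff.2 (sub_ne_zero.2 h)) ?_
  have := norm_sub_le x y
  nlinarith

lemma log_one_add_norm_nonneg (x : ℂ) : 0 ≤ Real.log (1 + ‖x‖) :=
  Real.log_nonneg (by linarith [norm_nonneg x])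

/-- A measure with a logarithmic moment and logarithmic energy less than `+∞` does not charge the
diagonal, and `log |x - y|` is integrable. -/
lemma integrable_log_of_logEnergy_ne_top {μ : Measure ℂ} [IsFiniteMeasure μ]
    (hlog : Integrable (fun x : ℂ => Real.log (1 + ‖x‖)) μ) (htop : logEnergy μ ≠ ⊤) :
    (∀ᵐ q ∂(μ.prod μ), q.1 ≠ q.2) ∧
      Integrable (fun q : ℂ × ℂ => Real.log ‖q.1 - q.2‖) (μ.prod μ) := by
  have hsum : Integrable (fun q : ℂ × ℂ => Real.log (1 + ‖q.1‖) + Real.log (1 + ‖q.2‖))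
      (μ.prod μ) := (hlog.comp_fst μ).add (hlog.comp_snd μ)
  -- The logarithmic moment bounds the negative part of the energy, so an infinite positive part
  -- would make the energy `⊤`.
  have hneg : ∫⁻ p : ℂ × ℂ, (-negLog p.1 p.2).toENNReal ∂(μ.prod μ) ≠ ∞ := by
    refine ne_top_of_le_ne_top hsum.lintegral_lt_top.ne (lintegral_mono fun q => ?_)
    by_cases hq : q.1 = q.2
    · rw [hq, negLog_self]; simp
    · rw [negLog_of_ne hq, ← EReal.coe_neg, neg_neg, EReal.real_coe_toENNReal]
      exact ENNReal.ofReal_le_ofReal (log_norm_sub_le _ _)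
  have hpos : ∫⁻ p : ℂ × ℂ, (negLog p.1 p.2).toENNReal ∂(μ.prod μ) ≠ ∞ := by
    intro h
    apply htop
    rw [logEnergy, h, ← EReal.coe_ennreal_toReal hneg, EReal.coe_ennreal_top,
      EReal.top_sub_coe]
  have hm := measurable_negLog.ereal_toENNReal
  have hne : ∀ᵐ q ∂(μ.prod μ), q.1 ≠ q.2 := by
    filter_upwards [ae_lt_top hm hpos] with q hq h
    rw [h, negLog_self] at hq
    simp at hq
  refine ⟨hne, measurable_log_norm_sub.aestronglyMeasurable, ?_⟩
  rw [HasFiniteIntegral]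
  calc ∫⁻ q : ℂ × ℂ, ‖Real.log ‖q.1 - q.2‖‖ₑ ∂(μ.prod μ)
      ≤ ∫⁻ q : ℂ × ℂ, ((negLog q.1 q.2).toENNReal
        + ENNReal.ofReal (Real.log (1 + ‖q.1‖) + Real.log (1 + ‖q.2‖))) ∂(μ.prod μ) := by
        refine lintegral_mono_ae ?_
        filter_upwards [hne] with q hq
        rw [negLog_of_ne hq, EReal.real_coe_toENNReal, ← ofReal_norm, Real.norm_eq_abs]
        rcases le_total 0 (Real.log ‖q.1 - q.2‖) with h | h
        · rw [abs_of_nonneg h]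
          exact (ENNReal.ofReal_le_ofReal (log_norm_sub_le _ _)).trans le_add_self
        · rw [abs_of_nonpos h]
          exact le_self_add
    _ < ∞ := by
        rw [lintegral_add_left hm]
        exact ENNReal.add_lt_top.2 ⟨lt_top_iff_ne_top.2 hpos, hsum.lintegral_lt_top⟩

/-- The uniform probability measure on a circle. -/
def circleMeasure (c : ℂ) (r : ℝ) : Measure ℂ :=
  ENNReal.ofReal (2 * Real.pi)⁻¹ • (volume.restrict (Set.Ioc 0 (2 * Real.pi))).map (circleMap c r)

instance (c : ℂ) (r : ℝ) : IsProbabilityMeasure (circleMeasure c r) := ⟨by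
  rw [circleMeasure, Measure.smul_apply, Measure.map_apply (by fun_prop) MeasurableSet.univ]
  simp only [Set.preimage_univ, Measure.restrict_apply_univ, Real.volume_Ioc, sub_zero, smul_eq_mul]
  rw [← ENNReal.ofReal_mul (by positivity), inv_mul_cancel₀ (by positivity), ENNReal.ofReal_one]⟩

lemma nullSingletonClass_circleMeasure (c : ℂ) {r : ℝ} (hr : r ≠ 0) :
    NullSingletonClass (circleMeasure c r) := ⟨fun z => by
  rw [circleMeasure, Measure.smul_apply, Measure.map_apply (by fun_prop) (measurableSet_singleton z),
    ((Set.countable_singleton z).preimage_circleMap c hr).measure_zero, smul_zero]⟩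

lemma integrable_circleMeasure {c : ℂ} {r : ℝ} {f : ℂ → ℝ} (hf : Measurable f)
    (hi : CircleIntegrable f c r) : Integrable f (circleMeasure c r) := by
  refine Integrable.smul_measure ?_ ENNReal.ofReal_ne_top
  rw [integrable_map_measure hf.aestronglyMeasurable (by fun_prop)]
  exact (intervalIntegrable_iff_integrableOn_Ioc_of_le (by positivity)).1 hi

lemma integral_circleMeasure (c : ℂ) (r : ℝ) {f : ℂ → ℝ} (hf : Measurable f) :
    ∫ z, f z ∂(circleMeasure c r) = Real.circleAverage f c r := by
  rw [circleMeasure, integral_smul_measure, integral_map (by fun_prop) hf.aestronglyMeasurable,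
    Real.circleAverage, intervalIntegral.integral_of_le (by positivity),
    ENNReal.toReal_ofReal (by positivity)]

/-- The mean of `log |z - y|` over the circle of centre `c` and radius `r`. -/
def circleLog (c : ℂ) (r : ℝ) (y : ℂ) : ℝ := Real.log r + Real.posLog (r⁻¹ * ‖c - y‖)

lemma circleAverage_log_eq (c : ℂ) {r : ℝ} (hr : r ≠ 0) (y : ℂ) :
    Real.circleAverage (fun z => Real.log ‖z - y‖) c r = circleLog c r y :=
  circleAverage_log_norm_sub_const_eq_log_radius_add_posLog hr

lemma measurable_circleLog (c : ℂ) (r : ℝ) : Measurable (circleLog c r) := by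
  unfold circleLog
  have : Measurable Real.posLog := measurable_const.max Real.measurable_log
  exact measurable_const.add (this.comp (by fun_prop))

/-- Newton's theorem: a uniform circle acts from outside like its centre, and its potential is
constant inside. -/
lemma circleLog_eq_max {c : ℂ} {r : ℝ} (hr : 0 < r) {y : ℂ} (hy : c ≠ y) :
    circleLog c r y = max (Real.log r) (Real.log ‖c - y‖) := by
  have h : 0 < ‖c - y‖ := norm_pos_iff.2 (sub_ne_zero.2 hy)
  rw [circleLog, Real.posLog, Real.log_mul (by positivity) (by positivity), Real.log_inv,
    ← max_add_add_left]
  simp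

lemma circleLog_self (c : ℂ) (r : ℝ) : circleLog c r c = Real.log r := by
  simp [circleLog]

lemma abs_circleLog_le {c : ℂ} {r : ℝ} (hr : 0 < r) (y : ℂ) :
    |circleLog c r y| ≤ |Real.log r| + (Real.log (1 + ‖c‖) + Real.log (1 + ‖y‖)) := by
  have h1 := log_one_add_norm_nonneg c
  have h2 := log_one_add_norm_nonneg y
  rcases eq_or_ne c y with rfl | hy
  · rw [circleLog_self]; linarith
  rw [circleLog_eq_max hr hy, abs_le]
  constructor
  · exact le_trans (by linarith [neg_abs_le (Real.log r)]) (le_max_left _ _)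
  · refine max_le (by linarith [le_abs_self (Real.log r)]) ?_
    linarith [log_norm_sub_le c y, abs_nonneg (Real.log r)]

lemma integrable_log_one_add_circleMeasure (c : ℂ) {r : ℝ} (hr : 0 ≤ r) :
    Integrable (fun z : ℂ => Real.log (1 + ‖z‖)) (circleMeasure c r) := by
  have hlc : Continuous fun z : ℂ => Real.log (1 + ‖z‖) :=
    Continuous.log (by fun_prop) fun z => by positivity
  exact integrable_circleMeasure hlc.measurable (hlc.continuousOn.circleIntegrable hr)

/-- `log |x - y|` is integrable for the product of a measure with a logarithmic moment and a
circle measure. -/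
lemma integrable_log_prod_circleMeasure {ν : Measure ℂ} [IsFiniteMeasure ν]
    (hlog : Integrable (fun x : ℂ => Real.log (1 + ‖x‖)) ν) (c : ℂ) {r : ℝ} (hr : 0 < r) :
    Integrable (fun q : ℂ × ℂ => Real.log ‖q.1 - q.2‖) (ν.prod (circleMeasure c r)) ∧
    ∫ q : ℂ × ℂ, Real.log ‖q.1 - q.2‖ ∂(ν.prod (circleMeasure c r)) = ∫ y, circleLog c r y ∂ν := by
  have hm : ∀ y : ℂ, Measurable fun z : ℂ => Real.log ‖y - z‖ := fun y => by fun_prop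
  have hci : ∀ y : ℂ, Integrable (fun z : ℂ => Real.log ‖y - z‖) (circleMeasure c r) := by
    intro y
    refine integrable_circleMeasure (hm y) ?_
    simp only [norm_sub_rev y]
    exact circleIntegrable_log_norm_sub_const r
  have hv : ∀ y : ℂ, ∫ z, Real.log ‖y - z‖ ∂(circleMeasure c r) = circleLog c r y := by
    intro y
    rw [integral_circleMeasure c r (hm y)]
    simp only [norm_sub_rev y]
    exact circleAverage_log_eq c hr.ne' y
  have hℓ := integrable_log_one_add_circleMeasure c hr.le
  have hs : ∀ y : ℂ, Integrable (fun z : ℂ => 2 * (Real.log (1 + ‖y‖) + Real.log (1 + ‖z‖)))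
      (circleMeasure c r) := fun y => ((integrable_const _).add hℓ).const_mul 2
  have hm2 := measurable_log_norm_sub.aestronglyMeasurable (μ := ν.prod (circleMeasure c r))
  have hi : Integrable (fun q : ℂ × ℂ => Real.log ‖q.1 - q.2‖) (ν.prod (circleMeasure c r)) := by
    rw [integrable_prod_iff hm2]
    refine ⟨ae_of_all _ hci, ?_⟩
    set K := ∫ z, Real.log (1 + ‖z‖) ∂(circleMeasure c r)
    refine Integrable.mono' (g := fun y => 2 * (Real.log (1 + ‖y‖) + K)
      + (|Real.log r| + (Real.log (1 + ‖c‖) + Real.log (1 + ‖y‖)))) ?_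
      hm2.norm.integral_prod_right' (ae_of_all _ fun y => ?_)
    · exact ((hlog.add (integrable_const _)).const_mul 2).add
        ((integrable_const _).add ((integrable_const _).add hlog))
    · rw [Real.norm_of_nonneg (integral_nonneg fun _ => norm_nonneg _)]
      -- If `t ≤ M` and `M ≥ 0`, then `|t| ≤ 2M - t`; this reduces the absolute value to the known
      -- circle mean.
      calc ∫ z, ‖Real.log ‖y - z‖‖ ∂(circleMeasure c r)
          ≤ ∫ z, (2 * (Real.log (1 + ‖y‖) + Real.log (1 + ‖z‖)) - Real.log ‖y - z‖)
            ∂(circleMeasure c r) := by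
            refine integral_mono (hci y).norm
              ((hs y).sub (hci y)) fun z => ?_
            have h1 := log_norm_sub_le y z
            have h2 := log_one_add_norm_nonneg y
            have h3 := log_one_add_norm_nonneg z
            simp only [Real.norm_eq_abs]
            rw [abs_le]; constructor <;> linarith
        _ = 2 * (Real.log (1 + ‖y‖) + K) - circleLog c r y := by
            rw [integral_sub (hs y) (hci y), hv,
              integral_const_mul, integral_add (integrable_const _) hℓ]
            simp [K]
        _ ≤ _ := by
            have := abs_circleLog_le (c := c) hr y
            linarith [neg_abs_le (circleLog c r y)]
  refine ⟨hi, ?_⟩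
  rw [integral_prod _ hi]
  simp only [hv]

lemma integral_log_prod_comm {μ ν : Measure ℂ} [SFinite μ] [SFinite ν] :
    ∫ q : ℂ × ℂ, Real.log ‖q.1 - q.2‖ ∂(ν.prod μ)
      = ∫ q : ℂ × ℂ, Real.log ‖q.1 - q.2‖ ∂(μ.prod ν) := by
  rw [← integral_prod_swap]
  simp only [Prod.fst_swap, Prod.snd_swap, norm_sub_rev]

lemma integrable_log_prod_comm {μ ν : Measure ℂ} [SFinite μ] [SFinite ν]
    (h : Integrable (fun q : ℂ × ℂ => Real.log ‖q.1 - q.2‖) (μ.prod ν)) :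
    Integrable (fun q : ℂ × ℂ => Real.log ‖q.1 - q.2‖) (ν.prod μ) := by
  have := h.swap
  simpa only [Function.comp_def, Prod.fst_swap, Prod.snd_swap, norm_sub_rev] using this

lemma weightedEnergy_eq {V : ℂ → ℝ} {μ : Measure ℂ} (hV : Integrable V μ)
    (hne : ∀ᵐ q ∂(μ.prod μ), q.1 ≠ q.2)
    (hi : Integrable (fun q : ℂ × ℂ => Real.log ‖q.1 - q.2‖) (μ.prod μ)) :
    weightedEnergy V μ = ((-(∫ q : ℂ × ℂ, Real.log ‖q.1 - q.2‖ ∂(μ.prod μ)) + ∫ x, V x ∂μ : ℝ) :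
      EReal) := by
  rw [weightedEnergy, if_pos hV, logEnergy_eq hne hi, EReal.coe_add]

lemma nonneg_of_forall_add_mul_nonneg {a b : ℝ} (h : ∀ t, 0 < t → t < 1 → 0 ≤ a + t * b) :
    0 ≤ a := by
  have h1 : Tendsto (fun t : ℝ => a + t * b) (𝓝[>] 0) (𝓝 a) := by
    have : Tendsto (fun t : ℝ => a + t * b) (𝓝 0) (𝓝 (a + 0 * b)) :=
      (tendsto_id.mul_const b).const_add a
    rw [zero_mul, add_zero] at this
    exact this.mono_left nhdsWithin_le_nhds
  refine ge_of_tendsto h1 ?_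
  filter_upwards [self_mem_nhdsWithin, nhdsWithin_le_nhds (Iio_mem_nhds one_pos)] with t h0 h2
  exact h t h0 h2

/-- The first variation of the energy at a minimizer, in the direction of a probability measure. -/
lemma first_variation {V : ℂ → ℝ} {μ σ : Measure ℂ} [IsProbabilityMeasure μ]
    [IsProbabilityMeasure σ] (hmin : ∀ ν : Measure ℂ, IsProbabilityMeasure ν →
      weightedEnergy V μ ≤ weightedEnergy V ν)
    (hVμ : Integrable V μ) (hVσ : Integrable V σ)
    (hneμ : ∀ᵐ q ∂(μ.prod μ), q.1 ≠ q.2) [NullSingletonClass σ]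
    (hμ : Integrable (fun q : ℂ × ℂ => Real.log ‖q.1 - q.2‖) (μ.prod μ))
    (hμσ : Integrable (fun q : ℂ × ℂ => Real.log ‖q.1 - q.2‖) (μ.prod σ))
    (hσ : Integrable (fun q : ℂ × ℂ => Real.log ‖q.1 - q.2‖) (σ.prod σ)) :
    -(∫ q : ℂ × ℂ, Real.log ‖q.1 - q.2‖ ∂(μ.prod μ)) + 2⁻¹ * ∫ x, V x ∂μ
      ≤ -(∫ q : ℂ × ℂ, Real.log ‖q.1 - q.2‖ ∂(μ.prod σ)) + 2⁻¹ * ∫ x, V x ∂σ := by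
  have hne1 : ∀ᵐ q ∂(μ.prod σ), q.1 ≠ q.2 := ae_prod_ne
  have hne2 : ∀ᵐ q ∂(σ.prod σ), q.1 ≠ q.2 := ae_prod_ne
  have hne3 : ∀ᵐ q ∂(σ.prod μ), q.1 ≠ q.2 := by
    have := (Measure.measurePreserving_swap (μ := σ) (ν := μ)).quasiMeasurePreserving.ae hne1
    filter_upwards [this] with q hq h
    exact hq h.symm
  have hσμ := integrable_log_prod_comm hμσ
  set A := ∫ q : ℂ × ℂ, Real.log ‖q.1 - q.2‖ ∂(μ.prod μ)
  set B := ∫ q : ℂ × ℂ, Real.log ‖q.1 - q.2‖ ∂(μ.prod σ) with hB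
  set D := ∫ q : ℂ × ℂ, Real.log ‖q.1 - q.2‖ ∂(σ.prod σ)
  have hB' : ∫ q : ℂ × ℂ, Real.log ‖q.1 - q.2‖ ∂(σ.prod μ) = B := integral_log_prod_comm
  suffices h : 0 ≤ 2 * A - 2 * B + (∫ x, V x ∂σ) - ∫ x, V x ∂μ by linarith
  -- The energy of `(1 - t) μ + t σ` is quadratic in `t`. Its increment divided by `t` is the
  -- first-order coefficient plus `t` times the second-order one, here `b`.
  refine nonneg_of_forall_add_mul_nonneg (b := -A + 2 * B - D) fun t h0 h1 => ?_
  set a : ℝ≥0∞ := ENNReal.ofReal (1 - t) with ha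
  set b : ℝ≥0∞ := ENNReal.ofReal t with hb
  have ha1 : a ≠ ∞ := ENNReal.ofReal_ne_top
  have hb1 : b ≠ ∞ := ENNReal.ofReal_ne_top
  have haR : a.toReal = 1 - t := ENNReal.toReal_ofReal (by linarith)
  have hbR : b.toReal = t := ENNReal.toReal_ofReal h0.le
  have : IsFiniteMeasure (a • μ) := μ.smul_finite ha1
  have : IsFiniteMeasure (b • σ) := σ.smul_finite hb1
  have hprob : IsProbabilityMeasure (a • μ + b • σ) := ⟨by
    simp only [Measure.add_apply, Measure.smul_apply, measure_univ, smul_eq_mul, mul_one]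
    rw [ha, hb, ← ENNReal.ofReal_add (by linarith) h0.le]
    simp⟩
  have hexp : (a • μ + b • σ).prod (a • μ + b • σ)
      = (a • a • μ.prod μ + a • b • μ.prod σ) + (b • a • σ.prod μ + b • b • σ.prod σ) := by
    rw [Measure.add_prod, Measure.prod_add, Measure.prod_add, Measure.prod_smul_left,
      Measure.prod_smul_left, Measure.prod_smul_left, Measure.prod_smul_left,
      Measure.prod_smul_right, Measure.prod_smul_right, Measure.prod_smul_right,
      Measure.prod_smul_right]
  have hm := hmin _ hprob
  have i1 := (hμ.smul_measure ha1).smul_measure ha1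
  have i2 := (hμσ.smul_measure hb1).smul_measure ha1
  have i3 := (hσμ.smul_measure ha1).smul_measure hb1
  have i4 := (hσ.smul_measure hb1).smul_measure hb1
  rw [weightedEnergy_eq hVμ hneμ hμ, weightedEnergy_eq
    ((hVμ.smul_measure ha1).add_measure (hVσ.smul_measure hb1)), EReal.coe_le_coe_iff, hexp,
    integral_add_measure (i1.add_measure i2) (i3.add_measure i4), integral_add_measure i1 i2,
    integral_add_measure i3 i4, integral_add_measure (hVμ.smul_measure ha1)
    (hVσ.smul_measure hb1)] at hm
  · simp only [integral_smul_measure, haR, hbR, smul_eq_mul, hB'] at hm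
    have : 0 ≤ t * (2 * A - 2 * B + (∫ x, V x ∂σ) - (∫ x, V x ∂μ) + t * (-A + 2 * B - D)) := by
      linarith
    exact nonneg_of_mul_nonneg_right this h0
  · rw [hexp]
    simp only [ae_add_measure_iff]
    exact ⟨⟨Measure.ae_smul_measure (Measure.ae_smul_measure hneμ _) _,
      Measure.ae_smul_measure (Measure.ae_smul_measure hne1 _) _⟩,
      Measure.ae_smul_measure (Measure.ae_smul_measure hne3 _) _,
      Measure.ae_smul_measure (Measure.ae_smul_measure hne2 _) _⟩
  · rw [hexp]
    exact (i1.add_measure i2).add_measure (i3.add_measure i4)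

end CoulombGas

end

/-! ### Regularity of the equilibrium measure -/

noncomputable section

namespace CoulombGas

/-- Taylor expansion: the linear term has mean zero on the circle, and the remainder is controlled
by a bound of the second derivative on a slightly larger disc, uniform in the centre. -/
lemma exists_circleAverage_sub_le {V : ℂ → ℝ} (hV : ContDiff ℝ 2 V) (ρ : ℝ) :
    ∃ K : ℝ, 0 ≤ K ∧ ∀ x : ℂ, ‖x‖ ≤ ρ → ∀ r : ℝ, 0 < r → r ≤ 1 →
      Real.circleAverage V x r ≤ V x + K * r ^ 2 := by
  have h1 : ContDiff ℝ 1 (fderiv ℝ V) := hV.fderiv_right (by norm_num)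
  obtain ⟨K, hK⟩ := (isCompact_closedBall (0 : ℂ) (ρ + 1)).exists_bound_of_continuousOn
    (h1.continuous_fderiv one_ne_zero).continuousOn
  refine ⟨|K|, abs_nonneg K, fun x hx r hr hr1 => ?_⟩
  have hsub : ∀ y ∈ Metric.closedBall x r, y ∈ Metric.closedBall (0 : ℂ) (ρ + 1) := by
    intro y hy
    rw [mem_closedBall_iff_norm] at hy
    rw [mem_closedBall_zero_iff]
    have := norm_sub_norm_le y x
    linarith
  have hxr : x ∈ Metric.closedBall x r := Metric.mem_closedBall_self hr.le
  have hlip : ∀ y ∈ Metric.closedBall x r, ‖fderiv ℝ V y - fderiv ℝ V x‖ ≤ |K| * r := by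
    intro y hy
    refine ((convex_closedBall x r).norm_image_sub_le_of_norm_fderiv_le
      (fun z _ => (h1.differentiable one_ne_zero) z)
      (fun z hz => (hK z (hsub z hz)).trans (le_abs_self K)) hxr hy).trans ?_
    gcongr
    exact mem_closedBall_iff_norm.1 hy
  have htay : ∀ y ∈ Metric.sphere x |r|, V y ≤ (V x + |K| * r ^ 2) + fderiv ℝ V x (y - x) := by
    intro y hy
    rw [abs_of_pos hr] at hy
    have hy' := Metric.sphere_subset_closedBall hy
    have h2 := (convex_closedBall x r).norm_image_sub_le_of_norm_fderiv_le'
      (fun z _ => (hV.differentiable two_ne_zero) z) hlip hxr hy'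
    rw [mem_sphere_iff_norm.1 hy] at h2
    have := le_abs_self (V y - V x - fderiv ℝ V x (y - x))
    rw [Real.norm_eq_abs] at h2
    nlinarith
  have hc : Continuous fun y => fderiv ℝ V x (y - x) := by fun_prop
  have hci : CircleIntegrable (fun y => fderiv ℝ V x (y - x)) x r :=
    hc.continuousOn.circleIntegrable hr.le
  have h0 : Real.circleAverage (fun y => fderiv ℝ V x (y - x)) x r = 0 := by
    have h3 : Real.circleAverage (fun y => y - x) x r = 0 := by
      have := DiffContOnCl.circleAverage (f := fun y : ℂ => y - x) (c := x) (R := r)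
        (Differentiable.diffContOnCl (by fun_prop))
      simpa using this
    have h4 := (fderiv ℝ V x).circleAverage_comp_comm (f := fun y => y - x) (c := x) (R := r)
      (ContinuousOn.circleIntegrable hr.le (by fun_prop))
    rw [h3, map_zero] at h4
    exact h4
  calc Real.circleAverage V x r
      ≤ Real.circleAverage (fun y => (V x + |K| * r ^ 2) + fderiv ℝ V x (y - x)) x r :=
        Real.circleAverage_mono (hV.continuous.continuousOn.circleIntegrable hr.le)
          ((circleIntegrable_const _ _ _).add hci) htay
    _ = V x + |K| * r ^ 2 := by
        rw [Real.circleAverage_fun_add (circleIntegrable_const _ _ _) hci, h0,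
          Real.circleAverage_const, add_zero]

section Growth

variable {V : ℂ → ℝ}

lemma tendsto_sub_log_one_add
    (hg : Tendsto (fun x : ℂ => V x / 2 - Real.log ‖x‖) (cocompact ℂ) atTop) :
    Tendsto (fun x : ℂ => V x / 2 - Real.log (1 + ‖x‖)) (cocompact ℂ) atTop := by
  have h1 : ∀ᶠ x : ℂ in cocompact ℂ, 1 ≤ ‖x‖ :=
    (tendsto_norm_cocompact_atTop (E := ℂ)).eventually_ge_atTop 1
  refine tendsto_atTop_mono' _ ?_ (tendsto_atTop_add_const_right _ (-Real.log 2) hg)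
  filter_upwards [h1] with x hx
  have : Real.log (1 + ‖x‖) ≤ Real.log 2 + Real.log ‖x‖ := by
    rw [← Real.log_mul two_ne_zero (by linarith)]
    exact Real.log_le_log (by linarith) (by linarith)
  linarith

lemma exists_log_one_add_le
    (hg : Tendsto (fun x : ℂ => V x / 2 - Real.log ‖x‖) (cocompact ℂ) atTop)
    (hV : Continuous V) : ∃ K : ℝ, ∀ x : ℂ, Real.log (1 + ‖x‖) ≤ V x / 2 + K := by
  have hlc : Continuous fun z : ℂ => Real.log (1 + ‖z‖) :=
    Continuous.log (by fun_prop) fun z => by positivity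
  obtain ⟨x, hx⟩ := ((hV.div_const 2).sub hlc).exists_forall_le (tendsto_sub_log_one_add hg)
  refine ⟨-(V x / 2 - Real.log (1 + ‖x‖)), fun y => ?_⟩
  have := hx y
  simp only [Pi.sub_apply] at this
  linarith

lemma integrable_log_one_add {μ : Measure ℂ} [IsFiniteMeasure μ]
    (hg : Tendsto (fun x : ℂ => V x / 2 - Real.log ‖x‖) (cocompact ℂ) atTop)
    (hV : Continuous V) (hi : Integrable V μ) :
    Integrable (fun x : ℂ => Real.log (1 + ‖x‖)) μ := by
  obtain ⟨K, hK⟩ := exists_log_one_add_le hg hV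
  refine ((hi.div_const 2).add (integrable_const K)).mono' ?_ (ae_of_all _ fun x => ?_)
  · exact (by fun_prop : Measurable fun x : ℂ => Real.log (1 + ‖x‖)).aestronglyMeasurable
  · rw [Real.norm_of_nonneg (log_one_add_norm_nonneg x)]
    exact hK x

end Growth

section Equilibrium

variable {V : ℂ → ℝ} {μ₀ : Measure ℂ}

/-- The constant `I(μ) - ½ ∫ V dμ`. -/
def energyConstant (V : ℂ → ℝ) (μ : Measure ℂ) : ℝ :=
  -(∫ q : ℂ × ℂ, Real.log ‖q.1 - q.2‖ ∂(μ.prod μ)) + 2⁻¹ * ∫ x, V x ∂μ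

/-- The unit circle measure is a competitor of finite energy; the growth of `V` supplies the
logarithmic moment. -/
lemma isFiniteEnergy (hg : Tendsto (fun x : ℂ => V x / 2 - Real.log ‖x‖) (cocompact ℂ) atTop)
    (hV : Continuous V) (h : IsEquilibriumMeasure V μ₀) :
    Integrable V μ₀ ∧ Integrable (fun x : ℂ => Real.log (1 + ‖x‖)) μ₀ ∧
      (∀ᵐ q ∂(μ₀.prod μ₀), q.1 ≠ q.2) ∧
      Integrable (fun q : ℂ × ℂ => Real.log ‖q.1 - q.2‖) (μ₀.prod μ₀) := by
  have := h.isProbabilityMeasure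
  have := nullSingletonClass_circleMeasure 0 one_ne_zero
  have hfin : weightedEnergy V μ₀ ≠ ⊤ := by
    refine ne_top_of_le_ne_top ?_ (h.energy_le (circleMeasure 0 1) inferInstance)
    rw [weightedEnergy_eq (integrable_circleMeasure hV.measurable
      (hV.continuousOn.circleIntegrable zero_le_one)) ae_prod_ne
      (integrable_log_prod_circleMeasure
        (integrable_log_one_add_circleMeasure 0 zero_le_one) 0 one_pos).1]
    exact EReal.coe_ne_top _
  have hVi : Integrable V μ₀ := by
    by_contra hn
    rw [weightedEnergy, if_neg hn] at hfin
    exact hfin rfl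
  have hlog := integrable_log_one_add hg hV hVi
  refine ⟨hVi, hlog, integrable_log_of_logEnergy_ne_top hlog fun htop => ?_⟩
  rw [weightedEnergy, if_pos hVi, htop, EReal.top_add_coe] at hfin
  exact hfin rfl

/-- The mean-value form of the Euler-Lagrange inequality. -/
lemma energyConstant_le_circle
    (hg : Tendsto (fun x : ℂ => V x / 2 - Real.log ‖x‖) (cocompact ℂ) atTop)
    (hV : Continuous V) (h : IsEquilibriumMeasure V μ₀) (x : ℂ) {r : ℝ} (hr : 0 < r) :
    energyConstant V μ₀ ≤ -(∫ y, circleLog x r y ∂μ₀) + 2⁻¹ * Real.circleAverage V x r := by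
  have := h.isProbabilityMeasure
  have := nullSingletonClass_circleMeasure x hr.ne'
  obtain ⟨hVi, hlog, hne, hi⟩ := isFiniteEnergy hg hV h
  obtain ⟨h1, h2⟩ := integrable_log_prod_circleMeasure hlog x hr
  have := first_variation h.energy_le hVi (integrable_circleMeasure hV.measurable
    (hV.continuousOn.circleIntegrable hr.le)) hne hi h1
    (integrable_log_prod_circleMeasure (integrable_log_one_add_circleMeasure x hr.le) x hr).1
  rwa [h2, integral_circleMeasure x r hV.measurable] at this

lemma nullSingletonClass_of_ae_prod_ne {μ : Measure ℂ} [SFinite μ]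
    (hne : ∀ᵐ q ∂(μ.prod μ), q.1 ≠ q.2) : NullSingletonClass μ := ⟨fun x => by
  rw [ae_iff] at hne
  have h1 : (μ.prod μ) ({x} ×ˢ {x}) = 0 := by
    refine measure_mono_null ?_ hne
    rintro ⟨a, b⟩ ⟨ha, hb⟩
    simp_all
  rw [Measure.prod_prod] at h1
  exact mul_self_eq_zero.1 h1⟩

lemma integrable_circleLog {μ : Measure ℂ} [IsFiniteMeasure μ]
    (hlog : Integrable (fun x : ℂ => Real.log (1 + ‖x‖)) μ) (x : ℂ) {r : ℝ} (hr : 0 < r) :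
    Integrable (circleLog x r) μ :=
  ((integrable_const |Real.log r|).add ((integrable_const (Real.log (1 + ‖x‖))).add hlog)).mono'
    (measurable_circleLog x r).aestronglyMeasurable (ae_of_all _ fun y => abs_circleLog_le hr y)

/-- The Euler-Lagrange inequality, at every point where the potential is finite. -/
lemma energyConstant_le
    (hg : Tendsto (fun x : ℂ => V x / 2 - Real.log ‖x‖) (cocompact ℂ) atTop)
    (hV : ContDiff ℝ 2 V) (h : IsEquilibriumMeasure V μ₀) {x : ℂ}
    (hx : Integrable (fun y => Real.log ‖x - y‖) μ₀) :
    energyConstant V μ₀ ≤ logPotential μ₀ x + V x / 2 := by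
  have := h.isProbabilityMeasure
  obtain ⟨hVi, hlog, hne, hi⟩ := isFiniteEnergy hg hV.continuous h
  have := nullSingletonClass_of_ae_prod_ne hne
  obtain ⟨K, -, hK⟩ := exists_circleAverage_sub_le hV ‖x‖
  set s : ℕ → ℝ := fun n => 1 / ((n : ℝ) + 1) with hs_def
  have hs : ∀ n, 0 < s n := fun n => by positivity
  have hs1 : ∀ n, s n ≤ 1 := fun n => by
    rw [hs_def, div_le_one (by positivity)]; linarith [n.cast_nonneg (α := ℝ)]
  have hs0 : Tendsto s atTop (𝓝 0) := tendsto_one_div_add_atTop_nhds_zero_nat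
  have hxy : ∀ᵐ y ∂μ₀, x ≠ y := by
    filter_upwards [show ∀ᵐ y ∂μ₀, y ≠ x by simp [ae_iff]] with y hy using hy.symm
  -- Shrink the circle to `x`. For radii at most `1`, `max (log r) (log|x - y|)` is dominated by
  -- `|log|x - y||`.
  have hlim : Tendsto (fun n => ∫ y, circleLog x (s n) y ∂μ₀) atTop
      (𝓝 (∫ y, Real.log ‖x - y‖ ∂μ₀)) := by
    refine tendsto_integral_of_dominated_convergence (fun y => |Real.log ‖x - y‖|)
      (fun n => (measurable_circleLog x (s n)).aestronglyMeasurable) hx.abs ?_ ?_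
    · intro n
      filter_upwards [hxy] with y hy
      have := Real.log_nonpos (hs n).le (hs1 n)
      rw [circleLog_eq_max (hs n) hy, Real.norm_eq_abs, abs_le]
      exact ⟨(neg_abs_le _).trans (le_max_right _ _),
        max_le (this.trans (abs_nonneg _)) (le_abs_self _)⟩
    · filter_upwards [hxy] with y hy
      have hpos : 0 < ‖x - y‖ := norm_pos_iff.2 (sub_ne_zero.2 hy)
      refine tendsto_const_nhds.congr' ?_
      filter_upwards [hs0.eventually_lt_const hpos] with n hn
      rw [circleLog_eq_max (hs n) hy, max_eq_right (Real.log_le_log (hs n) hn.le)]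
  have hlim2 : Tendsto (fun n => -(∫ y, circleLog x (s n) y ∂μ₀) + 2⁻¹ * (V x + K * s n ^ 2)) atTop
      (𝓝 (-(∫ y, Real.log ‖x - y‖ ∂μ₀) + 2⁻¹ * (V x + K * 0 ^ 2))) :=
    hlim.neg.add ((((hs0.pow 2).const_mul K).const_add (V x)).const_mul _)
  have := ge_of_tendsto' hlim2 (b := energyConstant V μ₀) fun n => by
    have h1 := energyConstant_le_circle hg hV.continuous h x (hs n)
    have h2 := hK x le_rfl (s n) (hs n) (hs1 n)
    linarith
  rw [logPotential]
  linarith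

/-- By `energyConstant_le` the difference of the two sides is nonnegative almost everywhere, and by
the choice of the constant its `μ₀`-integral vanishes. -/
lemma ae_energyConstant_eq
    (hg : Tendsto (fun x : ℂ => V x / 2 - Real.log ‖x‖) (cocompact ℂ) atTop)
    (hV : ContDiff ℝ 2 V) (h : IsEquilibriumMeasure V μ₀) :
    ∀ᵐ x ∂μ₀, Integrable (fun y => Real.log ‖x - y‖) μ₀ ∧
      logPotential μ₀ x + V x / 2 = energyConstant V μ₀ := by
  have := h.isProbabilityMeasure
  obtain ⟨hVi, hlog, hne, hi⟩ := isFiniteEnergy hg hV.continuous h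
  have hae := hi.prod_right_ae
  have hU : Integrable (logPotential μ₀) μ₀ := hi.integral_prod_left.neg
  have hF : Integrable (fun x => logPotential μ₀ x + V x / 2) μ₀ := hU.add (hVi.div_const 2)
  have hnn : 0 ≤ᵐ[μ₀] fun x => logPotential μ₀ x + V x / 2 - energyConstant V μ₀ := by
    filter_upwards [hae] with x hx
    exact sub_nonneg.2 (energyConstant_le hg hV h hx)
  have hzero : ∫ x, (logPotential μ₀ x + V x / 2 - energyConstant V μ₀) ∂μ₀ = 0 := by
    have e1 : ∫ x, logPotential μ₀ x ∂μ₀ = -∫ q : ℂ × ℂ, Real.log ‖q.1 - q.2‖ ∂(μ₀.prod μ₀) := by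
      rw [integral_prod _ hi, ← integral_neg]; rfl
    rw [integral_sub hF (integrable_const _), integral_add hU (hVi.div_const 2), e1, integral_div,
      integral_const, probReal_univ, one_smul, energyConstant]
    ring
  rw [integral_eq_zero_iff_of_nonneg_ae hnn (hF.sub (integrable_const _))] at hzero
  filter_upwards [hae, hzero] with x h1 h2
  exact ⟨h1, sub_eq_zero.1 h2⟩

/-- The potential is bounded below by `-log (1 + |x|)` minus a constant, while `V/2 - log (1 + |x|)`
tends to infinity, so equality fails far away. -/
lemma exists_norm_le_of_eq
    (hg : Tendsto (fun x : ℂ => V x / 2 - Real.log ‖x‖) (cocompact ℂ) atTop)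
    (hV : Continuous V) (h : IsEquilibriumMeasure V μ₀) :
    ∃ ρ : ℝ, ∀ x, Integrable (fun y => Real.log ‖x - y‖) μ₀ →
      logPotential μ₀ x + V x / 2 = energyConstant V μ₀ → ‖x‖ ≤ ρ := by
  have := h.isProbabilityMeasure
  obtain ⟨hVi, hlog, hne, hi⟩ := isFiniteEnergy hg hV h
  have hev := (tendsto_sub_log_one_add hg).eventually_gt_atTop
    (energyConstant V μ₀ + ∫ y, Real.log (1 + ‖y‖) ∂μ₀)
  rw [← Metric.cobounded_eq_cocompact, (Metric.hasBasis_cobounded_compl_closedBall 0).eventually_iff]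
    at hev
  obtain ⟨ρ, -, hρ⟩ := hev
  refine ⟨ρ, fun x hx heq => ?_⟩
  by_contra hn
  have h1 := hρ (x := x) (by simpa using hn)
  have h2 : ∫ y, Real.log ‖x - y‖ ∂μ₀ ≤ Real.log (1 + ‖x‖) + ∫ y, Real.log (1 + ‖y‖) ∂μ₀ := by
    calc _ ≤ ∫ y, (Real.log (1 + ‖x‖) + Real.log (1 + ‖y‖)) ∂μ₀ :=
          integral_mono hx ((integrable_const _).add hlog) fun y => log_norm_sub_le x y
      _ = _ := by rw [integral_add (integrable_const _) hlog]; simp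
  rw [logPotential] at heq
  linarith

/-- At a point where the Euler-Lagrange equality holds, small balls have measure of the order of
their area. -/
lemma measureReal_closedBall_le
    (hg : Tendsto (fun x : ℂ => V x / 2 - Real.log ‖x‖) (cocompact ℂ) atTop)
    (hV : Continuous V) (h : IsEquilibriumMeasure V μ₀) {x : ℂ}
    (hx : Integrable (fun y => Real.log ‖x - y‖) μ₀)
    (heq : logPotential μ₀ x + V x / 2 = energyConstant V μ₀) {K r : ℝ} (hr : 0 < r)
    (hK : Real.circleAverage V x (2 * r) ≤ V x + K * (2 * r) ^ 2) :
    Real.log 2 * μ₀.real (Metric.closedBall x r) ≤ 2 * K * r ^ 2 := by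
  have := h.isProbabilityMeasure
  obtain ⟨hVi, hlog, hne, hi⟩ := isFiniteEnergy hg hV h
  have := nullSingletonClass_of_ae_prod_ne hne
  have hr2 : 0 < 2 * r := by linarith
  have h1 := energyConstant_le_circle hg hV h x hr2
  have hci := integrable_circleLog hlog x hr2
  -- On the ball of radius `r`, replacing `log|x - y|` by its mean over the circle of radius `2r`
  -- gains at least `log 2`; elsewhere the gain is nonnegative. Minimality caps the total by half
  -- the excess of the mean of `V`.
  have h2 : Real.log 2 * μ₀.real (Metric.closedBall x r)
      ≤ ∫ y, (circleLog x (2 * r) y - Real.log ‖x - y‖) ∂μ₀ := by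
    rw [mul_comm, ← smul_eq_mul, ← integral_indicator_const _ measurableSet_closedBall]
    refine integral_mono_ae ((integrable_const _).indicator measurableSet_closedBall)
      (hci.sub hx) ?_
    filter_upwards [show ∀ᵐ y ∂μ₀, y ≠ x by simp [ae_iff]] with y hy
    have hpos : 0 < ‖x - y‖ := norm_pos_iff.2 (sub_ne_zero.2 hy.symm)
    rw [circleLog_eq_max hr2 hy.symm]
    by_cases hyb : y ∈ Metric.closedBall x r
    · rw [Set.indicator_of_mem hyb]
      rw [mem_closedBall_iff_norm, norm_sub_rev] at hyb
      have h3 := Real.log_le_log hpos hyb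
      have h4 := le_max_left (Real.log (2 * r)) (Real.log ‖x - y‖)
      rw [Real.log_mul two_ne_zero hr.ne'] at h4 ⊢
      linarith
    · rw [Set.indicator_of_notMem hyb]
      exact sub_nonneg.2 (le_max_right _ _)
  rw [integral_sub hci hx] at h2
  rw [logPotential] at heq
  nlinarith

/-- The equilibrium measure is compactly supported and has a bounded density. -/
theorem exists_le_smul_volume
    (hg : Tendsto (fun x : ℂ => V x / 2 - Real.log ‖x‖) (cocompact ℂ) atTop)
    (hV : ContDiff ℝ 2 V) (h : IsEquilibriumMeasure V μ₀) :
    ∃ (C : NNReal) (ρ : ℝ), μ₀ ≤ C • volume ∧ μ₀ (Metric.closedBall 0 ρ)ᶜ = 0 := by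
  have := h.isProbabilityMeasure
  obtain ⟨ρ, hρ⟩ := exists_norm_le_of_eq hg hV.continuous h
  obtain ⟨K, hK0, hK⟩ := exists_circleAverage_sub_le hV ρ
  have hae := ae_energyConstant_eq hg hV h
  have hlog2 : 0 < Real.log 2 := Real.log_pos one_lt_two
  -- The ball bound `2K r² / log 2` divided by the area `π r²`.
  refine ⟨(2 * K / Real.log 2 / Real.pi).toNNReal, ρ, ?_, ?_⟩
  · set C := (2 * K / Real.log 2 / Real.pi).toNNReal with hC
    have hCR : (C : ℝ) = 2 * K / Real.log 2 / Real.pi := Real.coe_toNNReal _ (by positivity)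
    set S := {x | Integrable (fun y => Real.log ‖x - y‖) μ₀ ∧
      logPotential μ₀ x + V x / 2 = energyConstant V μ₀} with hS
    have hSc : μ₀ Sᶜ = 0 := hae
    rw [Measure.le_iff]
    intro A _
    have h1 : μ₀ A ≤ μ₀ (A ∩ S) := by
      calc μ₀ A ≤ μ₀ ((A ∩ S) ∪ Sᶜ) := measure_mono fun x hx => by
            by_cases hxS : x ∈ S
            · exact Or.inl ⟨hx, hxS⟩
            · exact Or.inr hxS
        _ ≤ μ₀ (A ∩ S) + μ₀ Sᶜ := measure_union_le _ _
        _ = μ₀ (A ∩ S) := by rw [hSc, add_zero]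
    refine (h1.trans ?_).trans 
      (measure_mono (μ := C • (volume : Measure ℂ)) (Set.inter_subset_left (t := S)))
    -- At every point of equality small balls satisfy the bound, so a Besicovitch covering gives it
    -- for the whole set; the complement is `μ₀`-null.
    refine (Besicovitch.vitaliFamily μ₀).measure_le_of_frequently_le (C • volume)
      Measure.AbsolutelyContinuous.rfl _ fun x hx => ?_
    refine (Besicovitch.tendsto_filterAt μ₀ x).frequently (Eventually.frequently ?_)
    have hhalf : ∀ᶠ r : ℝ in 𝓝[>] 0, r ≤ 1 / 2 :=
      nhdsWithin_le_nhds (Iic_mem_nhds (by norm_num))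
    filter_upwards [hhalf, self_mem_nhdsWithin] with r hr1 hr0
    have hr0 : 0 < r := hr0
    have hb := measureReal_closedBall_le hg hV.continuous h hx.2.1 hx.2.2 hr0
      (hK x (hρ x hx.2.1 hx.2.2) (2 * r) (by linarith) (by linarith))
    rw [Measure.smul_apply, Complex.volume_closedBall, ← ofReal_measureReal, ENNReal.smul_def,
      smul_eq_mul, ← ENNReal.ofReal_coe_nnreal, hCR, ← ENNReal.ofReal_pow hr0.le,
      ← ENNReal.ofReal_coe_nnreal, ← ENNReal.ofReal_mul (by positivity),
      ← ENNReal.ofReal_mul (by positivity)]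
    refine ENNReal.ofReal_le_ofReal ?_
    rw [NNReal.coe_real_pi]
    have : 2 * K / Real.log 2 / Real.pi * (r ^ 2 * Real.pi) = 2 * K * r ^ 2 / Real.log 2 := by
      field_simp
    rw [this, le_div_iff₀ hlog2, mul_comm]
    exact hb
  · have : ∀ᵐ x ∂μ₀, x ∈ Metric.closedBall (0 : ℂ) ρ := by
      filter_upwards [hae] with x hx
      rw [mem_closedBall_zero_iff]
      exact hρ x hx.1 hx.2
    exact this

end Equilibrium

end CoulombGas

end

/-! ### The Euler-Lagrange constant -/

noncomputable section

namespace CoulombGas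

section EulerLagrange

variable {V : ℂ → ℝ} {μ₀ : Measure ℂ}

lemma hasZeroCapacity_empty : HasZeroCapacity ∅ := by
  intro K hK _ σ hσ h
  rw [Set.subset_empty_iff.1 hK, Set.compl_empty, measure_univ] at h
  exact absurd h one_ne_zero

lemma continuous_logPotential {μ : Measure ℂ} [IsFiniteMeasure μ] {C : NNReal} {ρ : ℝ}
    (hμ : μ ≤ C • volume) (h : μ (Metric.closedBall 0 ρ)ᶜ = 0) : Continuous (logPotential μ) := by
  have : Continuous fun x => ∫ y, Real.log ‖x - y‖ ∂μ := continuous_iff_continuousAt.2 fun x =>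
    (hasGradientAt_integral_log hμ h x).hasFDerivAt.continuousAt
  exact this.neg

/-- Existence of the constant in the Euler-Lagrange conditions. -/
theorem isEquilibriumConstant_energyConstant
    (hg : Tendsto (fun x : ℂ => V x / 2 - Real.log ‖x‖) (cocompact ℂ) atTop)
    (hV : ContDiff ℝ 2 V) (h : IsEquilibriumMeasure V μ₀) :
    IsEquilibriumConstant V μ₀ (energyConstant V μ₀) := by
  have := h.isProbabilityMeasure
  obtain ⟨C, ρ, hC, hρ⟩ := exists_le_smul_volume hg hV h
  have hcont : Continuous fun x => logPotential μ₀ x + V x / 2 :=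
    (continuous_logPotential hC hρ).add (hV.continuous.div_const 2)
  constructor
  -- The bounded density makes the potential finite and continuous everywhere, so both exceptional
  -- sets are in fact empty.
  · convert hasZeroCapacity_empty
    ext x
    simp only [Set.mem_ofPred_eq, Set.mem_empty_iff_false, iff_false, not_not]
    exact energyConstant_le hg hV h (integrable_log_norm_sub hC hρ x)
  · convert hasZeroCapacity_empty
    ext x
    simp only [Set.mem_ofPred_eq, Set.mem_empty_iff_false, iff_false, not_and, not_not]
    intro hx
    by_contra hne
    rw [Measure.mem_support_iff_forall] at hx
    -- Failure at a point of the support would persist on a neighbourhood, which has positive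
    -- measure, against equality almost everywhere.
    have hopen := (hcont.isOpen_preimage _ (isOpen_compl_singleton (x := energyConstant V μ₀)))
    refine (hx _ (hopen.mem_nhds hne)).ne' ?_
    have := ae_energyConstant_eq hg hV h
    rw [ae_iff] at this
    exact measure_mono_null (fun y hy => fun hy2 => hy hy2.2) this

/-- Uniqueness of the constant in the Euler-Lagrange conditions. -/
theorem IsEquilibriumConstant.eq_energyConstant
    (hg : Tendsto (fun x : ℂ => V x / 2 - Real.log ‖x‖) (cocompact ℂ) atTop)
    (hV : ContDiff ℝ 2 V) (h : IsEquilibriumMeasure V μ₀) {c : ℝ}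
    (hc : IsEquilibriumConstant V μ₀ c) : c = energyConstant V μ₀ := by
  have := h.isProbabilityMeasure
  obtain ⟨C, ρ, hC, hρ⟩ := exists_le_smul_volume hg hV h
  have hcont : Continuous fun x => logPotential μ₀ x + V x / 2 :=
    (continuous_logPotential hC hρ).add (hV.continuous.div_const 2)
  obtain ⟨-, -, hne, hi⟩ := isFiniteEnergy hg hV.continuous h
  by_contra hcc
  set S := {x | x ∈ Metric.closedBall (0 : ℂ) ρ ∧ x ∈ μ₀.support ∧
    logPotential μ₀ x + V x / 2 = energyConstant V μ₀} with hS
  have hScomp : IsCompact S := by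
    refine (isCompact_closedBall 0 ρ).inter_right (Measure.isClosed_support.inter ?_)
    exact isClosed_eq hcont continuous_const
  have hSc : μ₀ Sᶜ = 0 := by
    have h1 : ∀ᵐ x ∂μ₀, x ∈ Metric.closedBall (0 : ℂ) ρ := hρ
    have h2 : ∀ᵐ x ∂μ₀, x ∈ μ₀.support := Measure.measure_compl_support
    have h3 : ∀ᵐ x ∂μ₀, x ∈ S := by
      filter_upwards [h1, h2, ae_energyConstant_eq hg hV h] with x a b d using ⟨a, b, d.2⟩
    exact h3
  -- If `c` differed, the compact set `S`, which carries `μ₀`, would lie in the exceptional set; but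
  -- `μ₀` has finite logarithmic energy.
  have htop := hc.2 S (fun x hx => ⟨hx.2.1, fun h' => hcc (h'.symm.trans hx.2.2)⟩) hScomp μ₀
    inferInstance hSc
  rw [logEnergy_eq hne hi] at htop
  exact EReal.coe_ne_top _ htop

end EulerLagrange

/-! ### Scaling by `√n` -/

section BlowUp

variable {μ₀ : Measure ℂ} {n : ℕ}

lemma volume_eq_smul_map (hn : 1 ≤ n) :
    (volume : Measure ℂ) = (n : ℝ≥0∞) • volume.map (fun x : ℂ => √(n : ℝ) • x) := by
  have hn' : (0 : ℝ) < n := by exact_mod_cast hn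
  rw [Measure.map_addHaar_smul _ (Real.sqrt_pos.2 hn').ne', Complex.finrank_real_complex,
    Real.sq_sqrt hn'.le, abs_of_pos (by positivity), smul_smul, ENNReal.ofReal_inv_of_pos hn',
    ENNReal.ofReal_natCast, ENNReal.mul_inv_cancel (by exact_mod_cast hn'.ne') (by simp), one_smul]

lemma blowUpBackground_eq [SigmaFinite μ₀] {C : NNReal} (hμ : μ₀ ≤ C • volume) (hn : 1 ≤ n) :
    blowUpBackground n μ₀ = (n : ℝ≥0∞) • μ₀.map (fun x : ℂ => √(n : ℝ) • x) := by
  have hs : √(n : ℝ) ≠ 0 := (Real.sqrt_pos.2 (by exact_mod_cast hn)).ne'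
  have hac : μ₀ ≪ volume := Measure.absolutelyContinuous_of_le_smul (c := C) hμ
  have hm : Measurable fun x' : ℂ => μ₀.rnDeriv volume ((√(n : ℝ))⁻¹ • x') :=
    (Measure.measurable_rnDeriv _ _).comp (by fun_prop)
  have hms : Measurable fun x : ℂ => √(n : ℝ) • x := by fun_prop
  ext A hA
  have hd := Measure.withDensity_rnDeriv_eq _ _ hac
  rw [blowUpBackground, withDensity_apply _ hA]
  -- The density is made opaque so that only the outer Lebesgue measure is rewritten below.
  generalize μ₀.rnDeriv volume = f at hm hd ⊢
  conv_lhs => rw [volume_eq_smul_map hn]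
  rw [Measure.restrict_smul, lintegral_smul_measure, setLIntegral_map hA hm hms,
    Measure.smul_apply, Measure.map_apply hms hA]
  simp only [inv_smul_smul₀ hs]
  rw [← withDensity_apply _ (hms hA), hd]

/-- The mass and the area both grow by the factor `n`, so the same density bound survives. -/
lemma map_smul_le [IsFiniteMeasure μ₀] {C : NNReal} (hμ : μ₀ ≤ C • volume) (hn : 1 ≤ n) :
    (n : ℝ≥0∞) • μ₀.map (fun x : ℂ => √(n : ℝ) • x) ≤ C • volume := by
  have hms : Measurable fun x : ℂ => √(n : ℝ) • x := by fun_prop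
  have h1 := Measure.map_mono hμ hms
  rw [Measure.map_smul] at h1
  conv_rhs => rw [volume_eq_smul_map hn]
  rw [smul_comm C (n : ℝ≥0∞)]
  intro A
  simp only [Measure.smul_apply _ _ A, smul_eq_mul (n : ℝ≥0∞)]
  exact mul_le_mul_right (h1 A) _

lemma map_smul_compl_closedBall {ρ : ℝ} (h : μ₀ (Metric.closedBall 0 ρ)ᶜ = 0) :
    ((n : ℝ≥0∞) • μ₀.map (fun x : ℂ => √(n : ℝ) • x)) (Metric.closedBall 0 (√(n : ℝ) * ρ))ᶜ = 0 := by
  rw [Measure.smul_apply, Measure.map_apply (by fun_prop) measurableSet_closedBall.compl,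
    measure_mono_null _ h, smul_zero]
  intro x hx hx2
  apply hx
  rw [mem_closedBall_zero_iff] at hx2 ⊢
  rw [norm_smul, Real.norm_of_nonneg (Real.sqrt_nonneg _)]
  gcongr

lemma real_univ_map_smul [IsProbabilityMeasure μ₀] :
    ((n : ℝ≥0∞) • μ₀.map (fun x : ℂ => √(n : ℝ) • x)).real Set.univ = n := by
  rw [Measure.real, Measure.smul_apply, Measure.map_apply (by fun_prop) MeasurableSet.univ]
  simp

lemma log_norm_sqrt_smul_sub (hn : 1 ≤ n) {x y : ℂ} (h : x ≠ y) :
    Real.log ‖√(n : ℝ) • x - √(n : ℝ) • y‖ = Real.log n / 2 + Real.log ‖x - y‖ := by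
  have hn' : (0 : ℝ) < n := by exact_mod_cast hn
  rw [← smul_sub, norm_smul, Real.norm_of_nonneg (Real.sqrt_nonneg _),
    Real.log_mul (Real.sqrt_pos.2 hn').ne' (norm_ne_zero_iff.2 (sub_ne_zero.2 h)),
    Real.log_sqrt hn'.le]

lemma integral_log_map_smul [IsProbabilityMeasure μ₀] [NullSingletonClass μ₀] (hn : 1 ≤ n) {x : ℂ}
    (hi : Integrable (fun y => Real.log ‖x - y‖) μ₀) :
    ∫ y, Real.log ‖√(n : ℝ) • x - y‖ ∂((n : ℝ≥0∞) • μ₀.map (fun x : ℂ => √(n : ℝ) • x))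
      = n * (Real.log n / 2 - logPotential μ₀ x) := by
  have hm : Measurable fun y : ℂ => Real.log ‖√(n : ℝ) • x - y‖ := by fun_prop
  rw [integral_smul_measure, integral_map (by fun_prop) hm.aestronglyMeasurable]
  have : ∫ y, Real.log ‖√(n : ℝ) • x - √(n : ℝ) • y‖ ∂μ₀
      = ∫ y, (Real.log n / 2 + Real.log ‖x - y‖) ∂μ₀ := by
    refine integral_congr_ae ?_
    filter_upwards [show ∀ᵐ y ∂μ₀, y ≠ x by simp [ae_iff]] with y hy
    exact log_norm_sqrt_smul_sub hn hy.symm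
  rw [this, integral_add (integrable_const _) hi, logPotential]
  simp

lemma integral_log_prod_map_smul [IsProbabilityMeasure μ₀] (hn : 1 ≤ n)
    (hne : ∀ᵐ q ∂(μ₀.prod μ₀), q.1 ≠ q.2)
    (hi : Integrable (fun q : ℂ × ℂ => Real.log ‖q.1 - q.2‖) (μ₀.prod μ₀)) :
    ∫ q : ℂ × ℂ, Real.log ‖q.1 - q.2‖ ∂(((n : ℝ≥0∞) • μ₀.map (fun x : ℂ => √(n : ℝ) • x)).prod
        ((n : ℝ≥0∞) • μ₀.map (fun x : ℂ => √(n : ℝ) • x)))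
      = n * (n * (Real.log n / 2 + ∫ q : ℂ × ℂ, Real.log ‖q.1 - q.2‖ ∂(μ₀.prod μ₀))) := by
  have hms : Measurable fun x : ℂ => √(n : ℝ) • x := by fun_prop
  have : IsFiniteMeasure ((n : ℝ≥0∞) • μ₀.map (fun x : ℂ => √(n : ℝ) • x)) :=
    Measure.smul_finite _ (by simp)
  rw [Measure.prod_smul_left, Measure.prod_smul_right, Measure.map_prod_map _ _ hms hms,
    integral_smul_measure, integral_smul_measure,
    integral_map (hms.prodMap hms).aemeasurable measurable_log_norm_sub.aestronglyMeasurable]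
  have : ∫ q : ℂ × ℂ, Real.log ‖√(n : ℝ) • q.1 - √(n : ℝ) • q.2‖ ∂(μ₀.prod μ₀)
      = ∫ q : ℂ × ℂ, (Real.log n / 2 + Real.log ‖q.1 - q.2‖) ∂(μ₀.prod μ₀) := by
    refine integral_congr_ae ?_
    filter_upwards [hne] with q hq
    exact log_norm_sqrt_smul_sub hn hq
  simp only [Prod.map_fst, Prod.map_snd]
  rw [this, integral_add (integrable_const _) hi]
  simp

lemma blowUpPoints_pointMeasure (x : Fin n → ℂ) :
    blowUpPoints n (pointMeasure x) = pointMeasure fun i => √(n : ℝ) • x i := by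
  have hms : Measurable fun x : ℂ => √(n : ℝ) • x := by fun_prop
  rw [blowUpPoints, pointMeasure, Measure.map_finset_sum hms.aemeasurable, pointMeasure]
  simp only [Measure.map_dirac' hms]

lemma pointMeasure_real_univ (p : Fin n → ℂ) : (pointMeasure p).real Set.univ = n := by
  simp [pointMeasure, Measure.real, Measure.finsetSum_apply]

lemma integral_pointMeasure (p : Fin n → ℂ) (f : ℂ → ℝ) :
    ∫ x, f x ∂(pointMeasure p) = ∑ i, f (p i) := by
  rw [pointMeasure, integral_finsetSum_measure fun i _ => integrable_dirac (by simp)]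
  simp

lemma pointMeasure_singleton_ne_zero (p : Fin n → ℂ) (z : ℂ) :
    pointMeasure p {z} ≠ 0 ↔ ∃ i, p i = z := by
  rw [pointMeasure, Measure.finsetSum_apply, ne_eq, Finset.sum_eq_zero_iff]
  simp [Measure.dirac_apply' _ (measurableSet_singleton z), Set.indicator]

lemma compl_biUnion_ball_pointMeasure (p : Fin n → ℂ) (η : ℝ) :
    (⋃ z ∈ {z : ℂ | pointMeasure p {z} ≠ 0}, Metric.ball z η)ᶜ = puncturedPlane p η := by
  rw [puncturedPlane]
  congr 1
  ext y
  simp only [Set.mem_iUnion, Set.mem_ofPred_eq, pointMeasure_singleton_ne_zero]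
  constructor
  · rintro ⟨z, ⟨i, rfl⟩, hy⟩; exact ⟨i, hy⟩
  · rintro ⟨i, hy⟩; exact ⟨p i, ⟨i, rfl⟩, hy⟩

lemma gradient_potential {μ : Measure ℂ} [IsFiniteMeasure μ] {C : NNReal} {ρ : ℝ}
    (hμ : μ ≤ C • volume) (h : μ (Metric.closedBall 0 ρ)ᶜ = 0) (p : Fin n → ℂ) {x : ℂ}
    (hx : ∀ i, x ≠ p i) :
    gradient (fun x => logPotential (pointMeasure p) x - logPotential μ x) x
      = totalField p μ x := by
  apply HasGradientAt.gradient
  rw [hasGradientAt_iff_hasFDerivAt, totalField, map_sub, map_sum]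
  have h1 := (hasGradientAt_integral_log hμ h x).hasFDerivAt.sub
    (HasFDerivAt.fun_sum fun i (_ : i ∈ Finset.univ) =>
      (hasGradientAt_log_norm_sub (hx i)).hasFDerivAt)
  refine h1.congr_of_eventuallyEq (Eventually.of_forall fun y => ?_)
  simp only [logPotential, integral_pointMeasure, Pi.sub_apply]
  ring

/-- The renormalized energy of the blown-up configuration is a genuine limit. -/
theorem tendsto_truncatedEnergy_blowUp [IsProbabilityMeasure μ₀] {C : NNReal} {ρ : ℝ}
    (hμ : μ₀ ≤ C • volume) (h : μ₀ (Metric.closedBall 0 ρ)ᶜ = 0) (hn : 1 ≤ n) (x : Fin n → ℂ) :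
    Tendsto (truncatedEnergy (blowUpPoints n (pointMeasure x))
        (gradient (blownUpPotential n μ₀ (pointMeasure x)))) (𝓝[>] 0)
      (𝓝 (open Classical in if Function.Injective x
        then ((Real.pi * interactionEnergy (fun i => √(n : ℝ) • x i)
          ((n : ℝ≥0∞) • μ₀.map (fun x : ℂ => √(n : ℝ) • x)) : ℝ) : EReal) else ⊤)) := by
  classical
  have hs : √(n : ℝ) ≠ 0 := (Real.sqrt_pos.2 (by exact_mod_cast hn)).ne'
  set μ := (n : ℝ≥0∞) • μ₀.map (fun x : ℂ => √(n : ℝ) • x) with hμdef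
  set p : Fin n → ℂ := fun i => √(n : ℝ) • x i with hp
  have : IsFiniteMeasure μ := Measure.smul_finite _ (by simp)
  have hinj : Function.Injective p ↔ Function.Injective x :=
    ⟨fun hpi => Function.Injective.of_comp (f := fun z : ℂ => √(n : ℝ) • z) hpi,
      fun hxi => (smul_right_injective ℂ hs).comp hxi⟩
  have key := tendsto_truncated_totalField p μ (map_smul_le hμ hn) (map_smul_compl_closedBall h)
    real_univ_map_smul
  simp only [hinj] at key
  refine key.congr' ?_
  filter_upwards [self_mem_nhdsWithin] with η hη
  rw [truncatedEnergy, blowUpPoints_pointMeasure, compl_biUnion_ball_pointMeasure,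
    pointMeasure_real_univ]
  congr 3
  -- The gradient formula holds only off the charges, which is enough because their `η`-balls are
  -- removed.
  refine setLIntegral_congr_fun (measurableSet_puncturedPlane p η) fun y hy => ?_
  have hy' : ∀ i, y ≠ p i := by
    rintro i rfl
    have := (mem_puncturedPlane p).1 hy i
    rw [sub_self, norm_zero] at this
    exact absurd hη (not_lt.2 this)
  have e : blownUpPotential n μ₀ (pointMeasure x)
      = fun z => logPotential (pointMeasure p) z - logPotential μ z := by
    ext z
    rw [blownUpPotential, blowUpPoints_pointMeasure, blowUpBackground_eq hμ hn]
  rw [e, gradient_potential (map_smul_le hμ hn) (map_smul_compl_closedBall h) p hy']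

/-- Each logarithm gains `½ log n`, with total coefficient `-n(n - 1) + 2n² - n² = n`. -/
lemma interactionEnergy_blowUp [IsProbabilityMeasure μ₀] [NullSingletonClass μ₀] (hn : 1 ≤ n)
    (hne : ∀ᵐ q ∂(μ₀.prod μ₀), q.1 ≠ q.2)
    (hi : Integrable (fun q : ℂ × ℂ => Real.log ‖q.1 - q.2‖) (μ₀.prod μ₀))
    (hlog : ∀ x, Integrable (fun y => Real.log ‖x - y‖) μ₀) {x : Fin n → ℂ}
    (hx : Function.Injective x) :
    interactionEnergy (fun i => √(n : ℝ) • x i)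
        ((n : ℝ≥0∞) • μ₀.map (fun x : ℂ => √(n : ℝ) • x))
      = -(∑ i, ∑ j ∈ Finset.univ.erase i, Real.log ‖x i - x j‖) + n / 2 * Real.log n
        - 2 * n * ∑ i, logPotential μ₀ (x i)
        - n ^ 2 * ∫ q : ℂ × ℂ, Real.log ‖q.1 - q.2‖ ∂(μ₀.prod μ₀) := by
  have h1 : ∀ i, ∑ j ∈ Finset.univ.erase i, Real.log ‖√(n : ℝ) • x i - √(n : ℝ) • x j‖
      = (n - 1) * (Real.log n / 2) + ∑ j ∈ Finset.univ.erase i, Real.log ‖x i - x j‖ := by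
    intro i
    rw [Finset.sum_congr rfl fun j hj => log_norm_sqrt_smul_sub hn
      fun h => (Finset.ne_of_mem_erase hj) (hx h).symm, Finset.sum_add_distrib, Finset.sum_const,
      Finset.card_erase_of_mem (Finset.mem_univ i), Finset.card_univ, Fintype.card_fin,
      nsmul_eq_mul, Nat.cast_sub hn, Nat.cast_one]
  rw [interactionEnergy, integral_log_prod_map_smul hn hne hi]
  simp only [h1, integral_log_map_smul hn (hlog _)]
  simp only [Finset.sum_add_distrib, Finset.sum_const, Finset.card_univ, Fintype.card_fin,
    nsmul_eq_mul, ← Finset.mul_sum, Finset.sum_sub_distrib]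
  ring

end BlowUp

/-! ### The Hamiltonian in the extended reals -/

section Hamiltonian

variable {V : ℂ → ℝ} {n : ℕ}

lemma coe_sum_ereal {ι : Type*} (s : Finset ι) (f : ι → ℝ) :
    ((∑ i ∈ s, f i : ℝ) : EReal) = ∑ i ∈ s, (f i : EReal) := by
  classical
  induction s using Finset.induction_on with
  | empty => simp
  | insert a s ha ih => rw [Finset.sum_insert ha, Finset.sum_insert ha, EReal.coe_add, ih]

lemma sum_ereal_ne_bot {ι : Type*} (s : Finset ι) {f : ι → EReal} (h : ∀ i ∈ s, f i ≠ ⊥) :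
    ∑ i ∈ s, f i ≠ ⊥ := by
  refine Finset.sum_induction f (fun a => a ≠ ⊥) (fun a b ha hb => ?_) EReal.zero_ne_bot h
  exact EReal.add_ne_bot_iff.2 ⟨ha, hb⟩

/-- In `EReal` the sum `⊤ + ⊥` is `⊥`, so the other terms must be kept away from `⊥`. -/
lemma sum_ereal_eq_top {ι : Type*} [DecidableEq ι] {s : Finset ι} {f : ι → EReal}
    (h : ∀ i ∈ s, f i ≠ ⊥) {i : ι} (hi : i ∈ s) (hf : f i = ⊤) : ∑ i ∈ s, f i = ⊤ := by
  rw [← Finset.add_sum_erase s f hi, hf]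
  exact EReal.top_add_of_ne_bot (sum_ereal_ne_bot _ fun j hj => h j (Finset.mem_of_mem_erase hj))

lemma negLog_ne_bot (x y : ℂ) : negLog x y ≠ ⊥ := by
  by_cases h : x = y
  · rw [h, negLog_self]; simp
  · rw [negLog_of_ne h]; exact EReal.coe_ne_bot _

lemma hamiltonian_of_injective {x : Fin n → ℂ} (hx : Function.Injective x) :
    hamiltonian V x = ((-(∑ i, ∑ j ∈ Finset.univ.erase i, Real.log ‖x i - x j‖)
      + n * ∑ i, V (x i) : ℝ) : EReal) := by
  rw [hamiltonian, EReal.coe_add, ← Finset.sum_neg_distrib, coe_sum_ereal]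
  congr 1
  refine Finset.sum_congr rfl fun i _ => ?_
  rw [← Finset.sum_neg_distrib, coe_sum_ereal]
  refine Finset.sum_congr rfl fun j hj => ?_
  exact negLog_of_ne fun h => (Finset.ne_of_mem_erase hj) (hx h).symm

lemma hamiltonian_of_not_injective {x : Fin n → ℂ} (hx : ¬ Function.Injective x) :
    hamiltonian V x = ⊤ := by
  obtain ⟨a, b, hab, hne⟩ := Function.not_injective_iff.1 hx
  have h0 : negLog (x a) (x b) = ⊤ := by rw [hab, negLog_self]
  have h1 : ∑ j ∈ Finset.univ.erase a, negLog (x a) (x j) = ⊤ :=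
    sum_ereal_eq_top (fun j _ => negLog_ne_bot (x a) (x j))
      (Finset.mem_erase.2 ⟨fun h => hne h.symm, Finset.mem_univ b⟩) h0
  have h2 : ∑ i, ∑ j ∈ Finset.univ.erase i, negLog (x i) (x j) = ⊤ :=
    sum_ereal_eq_top (fun i _ => sum_ereal_ne_bot _ fun j _ => negLog_ne_bot (x i) (x j))
      (Finset.mem_univ a) h1
  rw [hamiltonian, h2]
  exact EReal.top_add_of_ne_bot (EReal.coe_ne_bot _)

end Hamiltonian

end CoulombGas

end

/-! ### Assembly of the splitting formula -/

noncomputable section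

namespace CoulombGas

variable {V : ℂ → ℝ} {μ₀ : Measure ℂ} {n : ℕ}

open Classical in
/-- The renormalized energy of the blown-up configuration. -/
lemma blownUpEnergy_eq [IsProbabilityMeasure μ₀] {C : NNReal} {ρ : ℝ}
    (hμ : μ₀ ≤ C • volume) (h : μ₀ (Metric.closedBall 0 ρ)ᶜ = 0) (hn : 1 ≤ n) (x : Fin n → ℂ) :
    blownUpEnergy n μ₀ (pointMeasure x) = if Function.Injective x
      then ((Real.pi * interactionEnergy (fun i => √(n : ℝ) • x i)
        ((n : ℝ≥0∞) • μ₀.map (fun x : ℂ => √(n : ℝ) • x)) : ℝ) : EReal) else ⊤ :=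
  (tendsto_truncatedEnergy_blowUp hμ h hn x).limUnder_eq

lemma sum_zeta (c : ℝ) (x : Fin n → ℂ) :
    ∑ i, zeta V μ₀ c (x i) = ∑ i, logPotential μ₀ (x i) + 2⁻¹ * ∑ i, V (x i) - n * c := by
  simp only [zeta, Finset.sum_sub_distrib, Finset.sum_add_distrib, Finset.mul_sum,
    div_eq_inv_mul]
  simp

lemma nextOrderEnergy_pointMeasure (c : ℝ) (x : Fin n → ℂ) :
    nextOrderEnergy V μ₀ c n (pointMeasure x)
      = ((1 / n : ℝ) : EReal) * (((1 / Real.pi : ℝ) : EReal) * blownUpEnergy n μ₀ (pointMeasure x)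
        + ((2 * n * ∑ i, zeta V μ₀ c (x i) : ℝ) : EReal)) := by
  rw [nextOrderEnergy, if_pos ⟨x, rfl⟩, integral_pointMeasure]

end CoulombGas

end

open CoulombGas in
theorem mainTheorem6 (V : ℂ → ℝ)
    (hV_growth : Tendsto (fun x : ℂ => V x / 2 - Real.log ‖x‖) (cocompact ℂ) atTop)
    (hV_smooth : ContDiff ℝ 3 V)
    (hV_laplacian : ∃ m M : ℝ, 0 < m ∧ 0 < M ∧ ∀ x : ℂ,
      m ≤ Laplacian.laplacian V x / (4 * Real.pi) ∧
      Laplacian.laplacian V x / (4 * Real.pi) ≤ M)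
    (μ₀ : Measure ℂ) (hμ₀ : CoulombGas.IsEquilibriumMeasure V μ₀) :
    (∃ c : ℝ, CoulombGas.IsEquilibriumConstant V μ₀ c) ∧
    ∀ c : ℝ, CoulombGas.IsEquilibriumConstant V μ₀ c →
      ∀ n : ℕ, 1 ≤ n → ∀ x : Fin n → ℂ,
        Tendsto
          (CoulombGas.truncatedEnergy
            (CoulombGas.blowUpPoints n (CoulombGas.pointMeasure x))
            (gradient (CoulombGas.blownUpPotential n μ₀ (CoulombGas.pointMeasure x))))
          (𝓝[>] (0 : ℝ)) (𝓝 (CoulombGas.blownUpEnergy n μ₀ (CoulombGas.pointMeasure x))) ∧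
        CoulombGas.hamiltonian V x =
          (((n : ℝ) ^ 2 : ℝ) : EReal) * CoulombGas.weightedEnergy V μ₀
            - ((n / 2 * Real.log n : ℝ) : EReal)
            + ((1 / Real.pi : ℝ) : EReal)
                * CoulombGas.blownUpEnergy n μ₀ (CoulombGas.pointMeasure x)
            + ((2 * n * ∑ i, CoulombGas.zeta V μ₀ c (x i) : ℝ) : EReal) ∧
        CoulombGas.nextOrderEnergy V μ₀ c n (CoulombGas.pointMeasure x) =
          ((1 / (n * Real.pi) : ℝ) : EReal)
                * CoulombGas.blownUpEnergy n μ₀ (CoulombGas.pointMeasure x)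
            + ((2 * ∑ i, CoulombGas.zeta V μ₀ c (x i) : ℝ) : EReal) ∧
        CoulombGas.nextOrderEnergy V μ₀ c n (CoulombGas.pointMeasure x) =
          ((1 / n : ℝ) : EReal) *
            (CoulombGas.hamiltonian V x
              - (((n : ℝ) ^ 2 : ℝ) : EReal) * CoulombGas.weightedEnergy V μ₀
              + ((n / 2 * Real.log n : ℝ) : EReal)) := by
  have := hμ₀.isProbabilityMeasure
  have hV2 : ContDiff ℝ 2 V := hV_smooth.of_le (by norm_num)
  refine ⟨⟨_, isEquilibriumConstant_energyConstant hV_growth hV2 hμ₀⟩, ?_⟩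
  rintro c hc n hn x
  obtain ⟨C, ρ, hC, hρ⟩ := exists_le_smul_volume hV_growth hV2 hμ₀
  obtain ⟨hVi, -, hne, hi⟩ := isFiniteEnergy hV_growth hV2.continuous hμ₀
  have := nullSingletonClass_of_ae_prod_ne hne
  have hn0 : (n : ℝ) ≠ 0 := by positivity
  have hn' : (0 : ℝ) < n := by positivity
  have hlim := tendsto_truncatedEnergy_blowUp hC hρ hn x
  -- `renormalizedEnergy` is a `limUnder`, meaningful only once convergence is known; here it is
  -- identified with the computed limit.
  rw [← blownUpEnergy_eq hC hρ hn x] at hlim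
  refine ⟨hlim, ?_⟩
  rw [nextOrderEnergy_pointMeasure, blownUpEnergy_eq hC hρ hn x, weightedEnergy_eq hVi hne hi,
    sum_zeta, hc.eq_energyConstant hV_growth hV2 hμ₀]
  by_cases hx : Function.Injective x
  · rw [if_pos hx, hamiltonian_of_injective hx, interactionEnergy_blowUp hn hne hi
      (integrable_log_norm_sub hC hρ) hx, energyConstant]
    -- All terms are finite, and the claims become real algebra: inserting `c = I(μ₀) - ½ ∫ V dμ₀`
    -- into `2n ∑ ζ` cancels the potentials and every term in `μ₀` alone, leaving `w_n`.
    simp only [← EReal.coe_mul, ← EReal.coe_add, ← EReal.coe_sub, EReal.coe_eq_coe_iff]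
    refine ⟨?_, ?_, ?_⟩
    · field_simp
      ring
    · field_simp
    · field_simp
      ring
  -- With coinciding points the only infinite terms are `⊤`, with positive coefficients, so every
  -- side is `⊤`.
  · rw [if_neg hx, hamiltonian_of_not_injective hx,
      EReal.coe_mul_top_of_pos (show (0 : ℝ) < 1 / Real.pi by positivity),
      EReal.coe_mul_top_of_pos (show (0 : ℝ) < 1 / (n * Real.pi) by positivity)]
    simp only [← EReal.coe_mul, ← EReal.coe_sub, EReal.coe_add_top, EReal.top_add_coe,
      EReal.top_sub_coe, EReal.coe_mul_top_of_pos (show (0 : ℝ) < 1 / n by positivity), and_self]
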